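/- For an $N\times N$ unitary matrix $A$ with eigenvalues $e^{i\theta_1},\dots,e^{i\theta_N}$ (with multiplicity), let $$Z(\theta,A)=\det(I-Ae^{-i\theta})=\prod_{n=1}^N\bigl(1-e^{i(\theta_n-\theta)}\bigr),\qquad \theta\in\mathbb R,$$ and let $Z'$ be its derivative with respect to $\theta$, so that $Z'(\theta_r,A)=i\prod_{n\ne r}(1-e^{i(\theta_n-\theta_r)})$. Complex powers of $Z'(\theta_r,A)$ are formed with the argument $$\arg Z'(\theta_r,A)=\frac{\pi}{2}+\sum_{n\neq r}\arg\bigl(1-e^{i(\theta_n-\theta_r)}\bigr),\qquad -\frac{\pi}{2}<\arg\bigl(1-e^{i(\theta_n-\theta_r)}\bigr)<\frac{\pi}{2},$$ that is, $Z'(\theta_r,A)^k=|Z'(\theta_r,A)|^k e^{ik\arg Z'(\theta_r,A)}$ (the values at the Haar-null set of matrices with a repeated eigenvalue are immaterial). Let $\mathbb E_N$ denote expectation with respect to the Haar probability measure on the unitary group $U(N)$. Let $k\in\mathbb C$ with $\operatorname{Re}(k)>-3$. Then for every $N\ge 1$ the function $A\mapsto\frac1N\sum_{n=1}^N Z'(\theta_n,A)^k$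 is Haar-integrable and $$\mathbb E_N\Bigl[\frac1N\sum_{n=1}^N Z'(\theta_n,A)^k\Bigr]=e^{i\pi k/2}\,\frac{\Gamma(N+k+1)}{N!\,\Gamma(k+2)},$$ where $1/\Gamma(0)=0$ and where, in the single case $N=1$, $k=-2$, in which both Gamma functions have a pole, the quotient $\Gamma(N+k+1)/\Gamma(k+2)$ is read as $1$. Moreover, for each fixed such $k$, $$\mathbb E_N\Bigl[\frac1N\sum_{n=1}^N Z'(\theta_n,A)^k\Bigr]\sim\frac{e^{i\pi k/2}}{\Gamma(k+2)}\,N^k\qquad(N\to\infty);$$ for $k=-2$ this means that both sides vanish for all $N\ge2$. -/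

import Mathlib

open Filter MeasureTheory Topology
open scoped Real

namespace UnitaryMoments

/-- The unitary group `U(N)`. -/
abbrev UN (N : ℕ) : Type := Matrix.unitaryGroup (Fin N) ℂ

section

open scoped Matrix.Norms.L2Operator in
theorem norm_eigenvalue_eq_one {N : ℕ} {A : Matrix (Fin N) (Fin N) ℂ}
    (hA : A ∈ Matrix.unitaryGroup (Fin N) ℂ) {w : ℂ} (hw : w ∈ spectrum ℂ A) : ‖w‖ = 1 := by
  simpa using spectrum.subset_circle_of_unitary hA hw

variable {N : ℕ}

/-- `Z(θ, A) = det (I - A e^{-iθ})`, as a function of the real variable `θ`. -/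
noncomputable def charZ (A : Matrix (Fin N) (Fin N) ℂ) (θ : ℝ) : ℂ :=
  (1 - Complex.exp (-(Complex.I * θ)) • A).det

/-- The eigenangles of `A`, in `(-π, π]`: the arguments of the eigenvalues of `A`, the latter
counted with algebraic multiplicity. -/
noncomputable def eigenangles (A : Matrix (Fin N) (Fin N) ℂ) : Multiset ℝ :=
  A.charpoly.roots.map Complex.arg

/-- The branch of `arg Z'(θ_r, A)` at an eigenangle `θ = θ_r`. Since
`Z'(θ_r, A) = i ∏_{n ≠ r} (1 - e^{i(θ_n - θ_r)})`, it is `π/2` plus the sum over `n ≠ r` of the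
arguments of `1 - e^{i(θ_n - θ_r)}`, taken in `(-π/2, π/2)`; the factors have positive real part
when they do not vanish, so these are the principal arguments. -/
noncomputable def derivArg (A : Matrix (Fin N) (Fin N) ℂ) (θ : ℝ) : ℝ :=
  π / 2 +
    (((eigenangles A).erase θ).map
      fun φ : ℝ => (1 - Complex.exp (Complex.I * ((φ : ℂ) - θ))).arg).sum

/-- The complex power `Z'(θ_r, A)^k = |Z'(θ_r, A)|^k e^{i k arg Z'(θ_r, A)}` at an eigenangle, with
the branch `derivArg` of the argument; the prime is the derivative with respect to `θ`. -/
noncomputable def derivPow (k : ℂ) (A : Matrix (Fin N) (Fin N) ℂ) (θ : ℝ) : ℂ :=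
  ((‖deriv (charZ A) θ‖ : ℝ) : ℂ) ^ k * Complex.exp (Complex.I * k * derivArg A θ)

/-- `(1/N) ∑_{n=1}^N Z'(θ_n, A)^k`. -/
noncomputable def meanDerivPow (k : ℂ) (A : Matrix (Fin N) (Fin N) ℂ) : ℂ :=
  (1 / (N : ℂ)) * ((eigenangles A).map fun θ => derivPow k A θ).sum

/-- `Z(θ, A) = ∏_n (1 - e^{i(θ_n - θ)})`. -/
theorem charZ_eq_prod {A : Matrix (Fin N) (Fin N) ℂ} (hA : A ∈ Matrix.unitaryGroup (Fin N) ℂ)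
    (θ : ℝ) :
    charZ A θ =
      ((eigenangles A).map fun x : ℝ => 1 - Complex.exp (Complex.I * ((x : ℂ) - θ))).prod := by
  have hw : ∀ w ∈ A.charpoly.roots, ‖w‖ = 1 := by
    intro w hw
    have h1 := Matrix.mem_spectrum_of_isRoot_charpoly (Polynomial.isRoot_of_mem_roots hw)
    have h2 := norm_eigenvalue_eq_one hA h1
    exact h2
  have hsplit : A.charpoly.Splits := IsAlgClosed.splits _
  have hcard : A.charpoly.roots.card = N := by
    rw [← hsplit.natDegree_eq_card_roots, Matrix.charpoly_natDegree_eq_dim, Fintype.card_fin]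
  set c : ℂ := Complex.exp (Complex.I * θ) with hc
  have hc' : Complex.exp (-(Complex.I * θ)) = c⁻¹ := by rw [Complex.exp_neg]
  have hc0 : c ≠ 0 := Complex.exp_ne_zero _
  have h1 : charZ A θ = c⁻¹ ^ N * A.charpoly.eval c := by
    have : (1 : Matrix (Fin N) (Fin N) ℂ) - c⁻¹ • A = c⁻¹ • (Matrix.scalar (Fin N) c - A) := by
      rw [smul_sub, Matrix.scalar_apply, ← Matrix.smul_one_eq_diagonal, smul_smul,
        inv_mul_cancel₀ hc0, one_smul]
    rw [charZ, hc', this, Matrix.det_smul, Matrix.eval_charpoly, Fintype.card_fin]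
  have h2 : A.charpoly.eval c = (A.charpoly.roots.map fun w => c - w).prod := by
    conv_lhs => rw [hsplit.eq_prod_roots_of_monic (Matrix.charpoly_monic A)]
    rw [Polynomial.eval_multiset_prod, Multiset.map_map]
    simp
  have h3 : c⁻¹ ^ N = (A.charpoly.roots.map fun _ => c⁻¹).prod := by
    rw [Multiset.map_const', Multiset.prod_replicate, hcard]
  rw [h1, h2, h3, ← Multiset.prod_map_mul, eigenangles, Multiset.map_map]
  congr 1
  refine Multiset.map_congr rfl fun w hwr => ?_
  have h4 : Complex.exp (Complex.I * (w.arg : ℂ)) = w := by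
    have := Complex.norm_mul_exp_arg_mul_I w
    rw [hw w hwr] at this
    rw [mul_comm]
    simpa using this
  rw [Function.comp_apply, mul_sub, mul_sub, Complex.exp_sub, h4, ← hc]
  field_simp

/-- `Z'(θ_r, A) = i ∏_{n ≠ r} (1 - e^{i(θ_n - θ_r)})`. -/
theorem deriv_charZ {A : Matrix (Fin N) (Fin N) ℂ} (hA : A ∈ Matrix.unitaryGroup (Fin N) ℂ)
    {θ : ℝ} (hθ : θ ∈ eigenangles A) :
    deriv (charZ A) θ = Complex.I *
      (((eigenangles A).erase θ).map
        fun x : ℝ => 1 - Complex.exp (Complex.I * ((x : ℂ) - θ))).prod := by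
  have hfac : ∀ x t : ℝ, HasDerivAt (fun t : ℝ => 1 - Complex.exp (Complex.I * ((x : ℂ) - t)))
      (Complex.I * Complex.exp (Complex.I * ((x : ℂ) - t))) t := by
    intro x t
    have h1 : HasDerivAt (fun t : ℝ => Complex.I * ((x : ℂ) - t)) (-Complex.I) t := by
      have := ((Complex.ofRealCLM.hasDerivAt (x := t)).const_sub (x : ℂ)).const_mul Complex.I
      simpa using this
    have h2 := (h1.cexp).const_sub 1
    refine h2.congr_deriv ?_
    ring
  have hdiff : ∀ (s : Multiset ℝ) (t : ℝ), DifferentiableAt ℝ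
      (fun t : ℝ => (s.map fun x : ℝ => 1 - Complex.exp (Complex.I * ((x : ℂ) - t))).prod) t := by
    intro s t
    induction s using Multiset.induction with
    | empty => simp
    | cons a s ih =>
      simp only [Multiset.map_cons, Multiset.prod_cons]
      exact (hfac a t).differentiableAt.mul ih
  have hfun : charZ A = fun t : ℝ => (1 - Complex.exp (Complex.I * ((θ : ℂ) - t))) *
      (((eigenangles A).erase θ).map
        fun x : ℝ => 1 - Complex.exp (Complex.I * ((x : ℂ) - t))).prod := by
    funext t
    rw [charZ_eq_prod hA]
    conv_lhs => rw [← Multiset.cons_erase hθ]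
    rw [Multiset.map_cons, Multiset.prod_cons]
  rw [hfun]
  have := (hfac θ θ).mul (hdiff ((eigenangles A).erase θ) θ).hasDerivAt
  refine this.deriv.trans ?_
  simp

/-- `derivArg` is indeed an argument of `Z'(θ_r, A)`. -/
theorem norm_mul_exp_derivArg {A : Matrix (Fin N) (Fin N) ℂ}
    (hA : A ∈ Matrix.unitaryGroup (Fin N) ℂ) {θ : ℝ} (hθ : θ ∈ eigenangles A) :
    ((‖deriv (charZ A) θ‖ : ℝ) : ℂ) * Complex.exp (Complex.I * derivArg A θ) =
      deriv (charZ A) θ := by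
  have key : ∀ (s : Multiset ℝ) (f : ℝ → ℂ), ((‖(s.map f).prod‖ : ℝ) : ℂ) *
      Complex.exp (Complex.I * ((s.map fun x => (f x).arg).sum : ℝ)) = (s.map f).prod := by
    intro s f
    induction s using Multiset.induction with
    | empty => simp
    | cons a s ih =>
      simp only [Multiset.map_cons, Multiset.prod_cons, Multiset.sum_cons]
      conv_rhs => rw [← ih, ← Complex.norm_mul_exp_arg_mul_I (f a)]
      rw [norm_mul, Complex.ofReal_add, mul_add, Complex.exp_add, mul_comm Complex.I ((f a).arg : ℂ)]
      push_cast
      ring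
  have hI : Complex.exp (Complex.I * ((π / 2 : ℝ) : ℂ)) = Complex.I := by
    rw [mul_comm]
    push_cast
    exact Complex.exp_pi_div_two_mul_I
  rw [deriv_charZ hA hθ, derivArg, norm_mul, Complex.norm_I, one_mul, Complex.ofReal_add, mul_add,
    Complex.exp_add, hI, mul_left_comm, key]

end

noncomputable instance instMeasurableSpaceUN (N : ℕ) : MeasurableSpace (UN N) := borel _

instance instBorelSpaceUN (N : ℕ) : BorelSpace (UN N) := ⟨rfl⟩

instance instCompactSpaceUN (N : ℕ) : CompactSpace (UN N) := by
  rw [← isCompact_univ_iff, Subtype.isCompact_iff, Set.image_univ, Subtype.range_coe]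
  have hK : IsCompact (Set.univ.pi fun _ : Fin N => Set.univ.pi fun _ : Fin N =>
      Metric.closedBall (0 : ℂ) 1) :=
    isCompact_univ_pi fun _ => isCompact_univ_pi fun _ => isCompact_closedBall _ _
  refine hK.of_isClosed_subset ?_ ?_
  · have : ((Matrix.unitaryGroup (Fin N) ℂ : Submonoid (Matrix (Fin N) (Fin N) ℂ)) :
        Set (Matrix (Fin N) (Fin N) ℂ)) = {A | star A * A = 1} := by
      ext A
      exact Matrix.mem_unitaryGroup_iff'
    have hc : IsClosed {A : Matrix (Fin N) (Fin N) ℂ | star A * A = 1} :=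
      isClosed_eq (by fun_prop) continuous_const
    rw [← this] at hc
    exact hc
  · intro A hA i _ j _
    simpa using entry_norm_bound_of_unitary hA i j

/-- The Haar measure on `U(N)`, normalised to be a probability measure. -/
noncomputable def haarUN (N : ℕ) : Measure (UN N) := Measure.haarMeasure ⊤

/-- `𝔼_N [ (1/N) ∑_{n=1}^N Z'(θ_n, A)^k ]`. -/
noncomputable def derivMoment (N : ℕ) (k : ℂ) : ℂ :=
  ∫ A : UN N, meanDerivPow k (A : Matrix (Fin N) (Fin N) ℂ) ∂(haarUN N)

end UnitaryMoments

/-!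
The eigenvalue distribution of a Haar unitary matrix is needed first, and it is obtained without
differential geometry, by comparing moments of the power sums `tr A ^ k`, `k ∈ ℤ`. Invariance of
Haar measure under `A ↦ exp (t X) A`, differentiated at `t = 0`, gives the loop equations
(`integral_loop`): the functional `f ↦ 𝔼 f(tr A, tr A², …)` kills the range of certain operators
`g ↦ loopPoly k * g + loopDer k g`. On symmetric Laurent polynomials in the eigenvalues, the
Laplacian of `U(N)` is a combination of these operators (`exists_laplace_vand_mul`), and after
multiplication by the Vandermonde determinant it becomes diagonal in the monomials, its kernel among
antisymmetric polynomials being the multiples of that determinant (`exists_eq_permExp`). So only the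
constant component of `f` contributes to the expectation, which is therefore the integral of `f`
against the Weyl density `|∏ (z_j - z_i)| ^ 2 / N!` (`eq_weyl_of_loop`, `integral_evalTrace`). By
Stone–Weierstrass on the space of power sums, this extends to all class functions
(`weyl_integration`).

For the `r`-th summand `Z'(θ_r) ^ k`, the variables `z_j / z_r` decouple from `z_r`, and the
expectation becomes an integral over `N - 1` variables against the Weyl density times
`∏ |1 - z_j| ^ 2 (1 - z_j) ^ k` (`derivMoment_succ`). The singularity at `z = 1` is integrable
exactly when `Re k > -3`. Andréief's identity turns the integral into the Toeplitz determinant of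
order `N - 1` of this weight (`integral_relWeight`), which on the circle equals
`-z⁻¹ (1 - z) ^ (k + 2)`. The matrix is thus, up to sign, a minor of the unitriangular Toeplitz
matrix of `(1 - z) ^ s`, `s = k + 2`, next to the diagonal; by Cramer's rule its determinant is an
entry of the inverse matrix, that is a coefficient of `(1 - z) ^ (-s)` (`det_binomCoeff`). The
outcome is the finite product `∏_{j < N - 1} (k + 2 + j) / N!` (`derivMoment_eq_prod`), which the
functional equation of `Γ` rewrites as the claimed quotient. Euler's limit formula for `Γ` gives the
asymptotics.
-/

namespace UnitaryMoments

/-! ### Laurent polynomials and their diagonal operators -/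

/-- Laurent polynomials in `N` variables: finite combinations of the monomials `z ^ μ`,
`μ : Fin N → ℤ`. -/
abbrev Laurent (N : ℕ) : Type := AddMonoidAlgebra ℂ (Fin N → ℤ)

namespace Laurent

variable {N : ℕ}

/-- The operator that multiplies the monomial `z ^ μ` by the scalar `t μ`. -/
noncomputable def diagOp (t : (Fin N → ℤ) → ℂ) : Laurent N →ₗ[ℂ] Laurent N where
  toFun F := .ofCoeff (Finsupp.onFinset F.coeff.support (fun μ => t μ * F.coeff μ)
    fun μ h => by simpa using right_ne_zero_of_mul h)
  map_add' F G := by ext μ; simp [mul_add]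
  map_smul' c F := by ext μ; simp [mul_left_comm]

@[simp] theorem coeff_diagOp (t : (Fin N → ℤ) → ℂ) (F : Laurent N) (μ : Fin N → ℤ) :
    (diagOp t F).coeff μ = t μ * F.coeff μ := rfl

theorem diagOp_single (t : (Fin N → ℤ) → ℂ) (μ : Fin N → ℤ) (a : ℂ) :
    diagOp t (.single μ a) = .single μ (t μ * a) := by
  classical
  ext ν
  simp only [coeff_diagOp, AddMonoidAlgebra.coeff_single, Finsupp.single_apply]
  split_ifs with h <;> simp [h]

theorem diagOp_mul (t : (Fin N → ℤ) → ℂ) (ht : ∀ μ ν, t (μ + ν) = t μ + t ν) (F G : Laurent N) :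
    diagOp t (F * G) = F * diagOp t G + G * diagOp t F := by
  induction F using AddMonoidAlgebra.induction_linear with
  | zero => simp
  | add F F' h h' => simp only [add_mul, mul_add, map_add, h, h']; ring
  | single μ a =>
    induction G using AddMonoidAlgebra.induction_linear with
    | zero => simp
    | add G G' h h' => simp only [add_mul, mul_add, map_add, h, h']; ring
    | single ν b =>
      simp only [AddMonoidAlgebra.single_mul_single, diagOp_single, ht]
      rw [add_comm ν μ, ← AddMonoidAlgebra.single_add]
      congr 1; ring

/-- The derivation `z_r ∂/∂z_r`. -/
noncomputable def euler (r : Fin N) : Derivation ℂ (Laurent N) (Laurent N) :=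
  Derivation.mk' (diagOp fun μ => (μ r : ℂ)) fun F G => by
    simpa using diagOp_mul _ (fun μ ν => by simp) F G

theorem euler_apply (r : Fin N) (F : Laurent N) : euler r F = diagOp (fun μ => (μ r : ℂ)) F := rfl

/-- The Laurent monomial `z_r ^ k`. -/
noncomputable def x (r : Fin N) (k : ℤ) : Laurent N := .single (Pi.single r k) 1

theorem x_add (r : Fin N) (k l : ℤ) : x r (k + l) = x r k * x r l := by
  simp [x, AddMonoidAlgebra.single_mul_single, Pi.single_add]

theorem x_zero (r : Fin N) : x r 0 = 1 := by simp [x, AddMonoidAlgebra.one_def]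

theorem x_pow (r : Fin N) (k : ℤ) (n : ℕ) : x r k ^ n = x r (n * k) := by
  induction n with
  | zero => simp [x_zero]
  | succ n ih => rw [pow_succ, ih, ← x_add]; congr 1; push_cast; ring

theorem euler_x (r s : Fin N) (k : ℤ) : euler r (x s k) = if r = s then (k : ℂ) • x s k else 0 := by
  rw [euler_apply, x, diagOp_single]
  split_ifs with h
  · subst h; simp
  · simp [h]

/-- The power sum `∑ r, z_r ^ k`. -/
noncomputable def psum (N : ℕ) (k : ℤ) : Laurent N := ∑ r, x r k

/-- The Vandermonde product `∏ i < j, (z_j - z_i)`, as a determinant. -/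
noncomputable def vand (N : ℕ) : Laurent N := (Matrix.vandermonde fun r : Fin N => x r 1).det

/-- The exponent `(σ 0, …, σ (N - 1))` of a term of the Vandermonde determinant. -/
def permExp (σ : Equiv.Perm (Fin N)) (r : Fin N) : ℤ := ((σ r : Fin N) : ℕ)

theorem permExp_injective : Function.Injective (permExp : Equiv.Perm (Fin N) → Fin N → ℤ) := by
  intro σ τ h
  ext r
  have := congrFun h r
  simpa [permExp] using this

theorem vand_eq_sum : vand N = ∑ σ : Equiv.Perm (Fin N),
    AddMonoidAlgebra.single (permExp σ) ((Equiv.Perm.sign σ : ℤ) : ℂ) := by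
  rw [vand, ← Matrix.det_transpose, Matrix.det_apply']
  refine Finset.sum_congr rfl fun σ _ => ?_
  have : ∀ i, (Matrix.vandermonde fun r : Fin N => x r 1).transpose (σ i) i
      = .single (Pi.single i (permExp σ i)) 1 := by
    intro i
    rw [Matrix.transpose_apply, Matrix.vandermonde_apply, x_pow, mul_one]
    rfl
  simp_rw [this]
  have h2 : ∏ i, (AddMonoidAlgebra.single (Pi.single i (permExp σ i)) 1 : Laurent N)
      = .single (permExp σ) 1 := by
    rw [AddMonoidAlgebra.prod_single]
    simp [Finset.univ_sum_single]
  rw [h2]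
  rcases Int.units_eq_one_or (Equiv.Perm.sign σ) with h | h <;>
    simp [h, AddMonoidAlgebra.single_neg]

theorem coeff_vand_permExp (σ : Equiv.Perm (Fin N)) :
    (vand N).coeff (permExp σ) = ((Equiv.Perm.sign σ : ℤ) : ℂ) := by
  classical
  rw [vand_eq_sum, AddMonoidAlgebra.coeff_sum, Finsupp.finsetSum_apply]
  simp_rw [AddMonoidAlgebra.coeff_single, Finsupp.single_apply, permExp_injective.eq_iff]
  simp

theorem vand_ne_zero : vand N ≠ 0 := by
  intro h
  have := coeff_vand_permExp (1 : Equiv.Perm (Fin N))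
  rw [h] at this
  simp at this

/-- The Virasoro (Witt) derivation `∑ r, z_r ^ k · z_r ∂/∂z_r`. -/
noncomputable def virasoro (k : ℤ) : Derivation ℂ (Laurent N) (Laurent N) :=
  ∑ r, x r k • euler r

theorem virasoro_apply (k : ℤ) (F : Laurent N) : virasoro k F = ∑ r, x r k * euler r F := by
  have := congrFun (map_sum (Derivation.coeFnAddMonoidHom (R := ℂ) (A := Laurent N)
    (M := Laurent N)) (fun r => x r k • euler r) Finset.univ) F
  rw [Finset.sum_apply] at this
  exact this

theorem virasoro_x (k : ℤ) (s : Fin N) (l : ℤ) : virasoro k (x s l) = (l : ℂ) • x s (k + l) := by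
  simp [virasoro_apply, euler_x, x_add]

theorem virasoro_psum (k l : ℤ) : virasoro k (psum N l) = (l : ℂ) • psum N (k + l) := by
  simp [psum, virasoro_x, Finset.smul_sum]

/-- A derivation acts on a product through the sum of the logarithmic derivatives `b i`. -/
theorem derivation_prod_eq {R A ι : Type*} [CommRing R] [CommRing A] [Algebra R A]
    (D : Derivation R A A) (s : Finset ι) (a b : ι → A) (h : ∀ i ∈ s, D (a i) = a i * b i) :
    D (∏ i ∈ s, a i) = (∏ i ∈ s, a i) * ∑ i ∈ s, b i := by
  classical
  induction s using Finset.induction_on with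
  | empty => simp
  | insert i s hi ih =>
    rw [Finset.prod_insert hi, Finset.sum_insert hi, Derivation.leibniz, smul_eq_mul, smul_eq_mul,
      ih fun j hj => h j (Finset.mem_insert_of_mem hj), h i (Finset.mem_insert_self _ _)]
    ring

/-- The quotient `(z_j ^ (k + 1) - z_i ^ (k + 1)) / (z_j - z_i)` as a Laurent polynomial; for
`i = j` this is the derivative `(k + 1) z_i ^ k`. -/
noncomputable def divDiff (i j : Fin N) : ℤ → Laurent N
  | .ofNat n => ∑ a ∈ Finset.range (n + 1), x i 1 ^ a * x j 1 ^ (n + 1 - 1 - a)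
  | .negSucc m => -(x i (-1) * x j (-1) *
      ∑ a ∈ Finset.range m, x i (-1) ^ a * x j (-1) ^ (m - 1 - a))

theorem mul_divDiff (i j : Fin N) (k : ℤ) :
    (x j 1 - x i 1) * divDiff i j k = x j (k + 1) - x i (k + 1) := by
  cases k with
  | ofNat n =>
    have := (Commute.all (x i 1) (x j 1)).geom_sum₂_mul (n + 1)
    rw [x_pow, x_pow] at this
    simp only [divDiff, Int.ofNat_eq_natCast, add_tsub_cancel_right]
    simp only [add_tsub_cancel_right, mul_one, Nat.cast_add, Nat.cast_one] at this
    linear_combination -this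
  | negSucc m =>
    have h := (Commute.all (x i (-1)) (x j (-1))).geom_sum₂_mul m
    have hi : x i 1 * x i (-1) = 1 := by rw [← x_add, add_neg_cancel, x_zero]
    have hj : x j 1 * x j (-1) = 1 := by rw [← x_add, add_neg_cancel, x_zero]
    simp only [x_pow] at h
    have e : Int.negSucc m + 1 = m * -1 := by rw [Int.negSucc_eq]; ring
    simp only [divDiff, e, x_pow]
    linear_combination (-1) * h +
      (∑ a ∈ Finset.range m, x i (a * -1) * x j ((m - 1 - a : ℕ) * -1)) *
        (x j (-1) * hi - x i (-1) * hj)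

theorem divDiff_comm (i j : Fin N) (k : ℤ) : divDiff i j k = divDiff j i k := by
  cases k with
  | ofNat n => exact (Commute.all (x i 1) (x j 1)).geom_sum₂_comm (n + 1)
  | negSucc m =>
    simp only [divDiff]
    rw [(Commute.all (x i (-1)) (x j (-1))).geom_sum₂_comm m, mul_comm (x i (-1))]

/-- The logarithmic derivative of the Vandermonde determinant under `virasoro k` is
`∑ i < j, divDiff i j k`; by symmetry the sum may be taken over all pairs. -/
theorem virasoro_vand (k : ℤ) :
    2 * virasoro k (vand N) = vand N * (∑ i, ∑ j, divDiff i j k - ∑ i, divDiff i i k) := by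
  have h1 : virasoro k (vand N) = vand N * ∑ i : Fin N, ∑ j ∈ Finset.Ioi i, divDiff i j k := by
    rw [vand, Matrix.det_vandermonde]
    refine derivation_prod_eq _ _ _ _ fun i _ => ?_
    refine derivation_prod_eq _ _ _ _ fun j _ => ?_
    rw [mul_divDiff, map_sub, virasoro_x, virasoro_x]
    simp
  have h2 : ∑ i : Fin N, ∑ j, divDiff i j k = ∑ i : Fin N, ∑ j ∈ Finset.Ioi i, divDiff i j k +
      ∑ i : Fin N, ∑ j ∈ Finset.Ioi i, divDiff i j k + ∑ i, divDiff i i k := by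
    have h3 : ∑ i : Fin N, ∑ j ∈ Finset.Iio i, divDiff i j k =
        ∑ i : Fin N, ∑ j ∈ Finset.Ioi i, divDiff i j k := by
      rw [Finset.sum_comm' (s' := fun j => Finset.Ioi j) (t' := Finset.univ) (by simp)]
      exact Finset.sum_congr rfl fun i _ => Finset.sum_congr rfl fun j _ => divDiff_comm _ _ _
    nth_rewrite 1 [← h3]
    rw [← Finset.sum_add_distrib, ← Finset.sum_add_distrib]
    refine Finset.sum_congr rfl fun i _ => ?_
    have : (Finset.univ : Finset (Fin N)) = insert i (Finset.Iio i ∪ Finset.Ioi i) := by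
      ext j; simp [em]
    rw [this, Finset.sum_insert (by simp), Finset.sum_union]
    · ring
    · exact Finset.disjoint_left.2 fun j h h' => by
        simp at h h'; omega
  rw [h2, h1]
  ring

end Laurent

/-- The polynomial `∑ i ∈ {1, …, k}, X_i X_{k - i}` in the power sums, and its analogue
`-∑ i ∈ {0, …, m - 1}, X_{-i} X_{i - m}` for `k = -m`: the contraction term of the loop
equations. -/
noncomputable def loopPoly : ℤ → MvPolynomial ℤ ℂ
  | .ofNat n => ∑ i ∈ Finset.range n, MvPolynomial.X (i + 1 : ℤ) * MvPolynomial.X (n - (i + 1) : ℤ)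
  | .negSucc m => -∑ i ∈ Finset.range (m + 1),
      MvPolynomial.X (-i : ℤ) * MvPolynomial.X (-(m + 1 - i) : ℤ)

/-- The derivation `X_l ↦ l X_{k + l}` of the ring of polynomials in the power sums. -/
noncomputable def loopDer (k : ℤ) : Derivation ℂ (MvPolynomial ℤ ℂ) (MvPolynomial ℤ ℂ) :=
  MvPolynomial.mkDerivation ℂ fun l => (l : ℂ) • MvPolynomial.X (k + l)

namespace Laurent

variable {N : ℕ}

/-- Substitution of the power sums `∑ r, z_r ^ k` for the indeterminates `X_k`, `k ∈ ℤ`. -/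
noncomputable def evalPsum (N : ℕ) : MvPolynomial ℤ ℂ →ₐ[ℂ] Laurent N :=
  MvPolynomial.aeval (psum N)

theorem psum_zero : psum N 0 = (N : Laurent N) := by simp [psum, x_zero]

theorem sum_x_mul_x (k l : ℤ) :
    ∑ i : Fin N, ∑ j : Fin N, x i k * x j l = psum N k * psum N l := by
  simp only [psum, Finset.sum_mul_sum]

/-- The contraction term of the loop equations comes from differentiating the square of the
Vandermonde determinant. -/
theorem virasoro_vand_loopPoly (k : ℤ) :
    2 * virasoro k (vand N) - (N - 1) * psum N k * vand N + (k : Laurent N) * psum N k * vand N =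
      vand N * evalPsum N (loopPoly k) := by
  rw [virasoro_vand]
  cases k with
  | ofNat n =>
    have h1 : ∑ i : Fin N, ∑ j : Fin N, divDiff i j (Int.ofNat n) =
        ∑ a ∈ Finset.range n, psum N (a + 1) * psum N (n - (a + 1)) + N * psum N n := by
      simp only [divDiff]
      simp_rw [Finset.sum_comm (s := (Finset.univ : Finset (Fin N))) (t := Finset.range _)]
      rw [Finset.sum_range_succ']
      congr 1
      · refine Finset.sum_congr rfl fun a ha => ?_
        rw [← sum_x_mul_x]
        refine Finset.sum_congr rfl fun i _ => Finset.sum_congr rfl fun j _ => ?_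
        rw [x_pow, x_pow]
        have := Finset.mem_range.1 ha
        congr 2
        · push_cast; ring
        · push_cast [Nat.sub_sub]
          omega
      · rw [← psum_zero, ← sum_x_mul_x]
        refine Finset.sum_congr rfl fun i _ => Finset.sum_congr rfl fun j _ => ?_
        rw [x_pow, x_pow]
        simp
    have h2 : ∑ i : Fin N, divDiff i i (Int.ofNat n) = (n + 1) * psum N n := by
      rw [psum, Finset.mul_sum]
      refine Finset.sum_congr rfl fun i _ => ?_
      simp only [divDiff]
      rw [geom_sum₂_self, x_pow]
      simp
    rw [h1, h2]
    simp only [loopPoly, evalPsum, map_sum, map_mul, MvPolynomial.aeval_X, Int.ofNat_eq_natCast]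
    push_cast
    ring
  | negSucc m =>
    have h1 : ∑ i : Fin N, ∑ j : Fin N, divDiff i j (Int.negSucc m) =
        -∑ a ∈ Finset.range (m + 1), psum N (-a) * psum N (-(m + 1 - a)) +
          N * psum N (Int.negSucc m) := by
      rw [Finset.sum_range_succ']
      simp only [divDiff, Finset.sum_neg_distrib, Finset.mul_sum]
      simp_rw [Finset.sum_comm (s := (Finset.univ : Finset (Fin N))) (t := Finset.range _)]
      have h3 : psum N (-((0 : ℕ) : ℤ)) * psum N (-(m + 1 - ((0 : ℕ) : ℤ)))
          = N * psum N (Int.negSucc m) := by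
        rw [Int.negSucc_eq]; simp [psum_zero]
      have h4 : ∀ a ∈ Finset.range m, ∑ i : Fin N, ∑ j : Fin N,
          x i (-1) * x j (-1) * (x i (-1) ^ a * x j (-1) ^ (m - 1 - a)) =
          psum N (-((a + 1 : ℕ) : ℤ)) * psum N (-(m + 1 - ((a + 1 : ℕ) : ℤ))) := by
        intro a ha
        have := Finset.mem_range.1 ha
        rw [← sum_x_mul_x]
        refine Finset.sum_congr rfl fun i _ => Finset.sum_congr rfl fun j _ => ?_
        rw [x_pow, x_pow, mul_mul_mul_comm, ← x_add, ← x_add]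
        congr 2
        · push_cast; ring
        · push_cast
          omega
      rw [h3, Finset.sum_congr rfl h4]
      ring
    have h2 : ∑ i : Fin N, divDiff i i (Int.negSucc m) = -(m * psum N (Int.negSucc m)) := by
      rw [psum, Finset.mul_sum, ← Finset.sum_neg_distrib]
      refine Finset.sum_congr rfl fun i _ => ?_
      simp only [divDiff]
      rw [geom_sum₂_self, x_pow, ← x_add]
      rcases m with _ | m
      · simp
      · rw [mul_left_comm, ← x_add]
        congr 3
        rw [Int.negSucc_eq]; push_cast; simp; ring
    rw [h1, h2]
    simp only [loopPoly, evalPsum, map_sum, map_neg, map_mul, MvPolynomial.aeval_X]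
    rw [Int.cast_negSucc]
    push_cast
    ring

/-! ### The Laplacian in the eigenvalue variables -/

/-- The eigenvalue of the Laplacian at the monomial `z ^ μ` of an antisymmetric Laurent polynomial,
normalised to vanish at the exponents of the Vandermonde determinant. -/
def casimir (μ : Fin N → ℤ) : ℤ :=
  ∑ r, (μ r ^ 2 - (N - 1) * μ r) - ∑ r : Fin N, (((r : ℕ) : ℤ) ^ 2 - (N - 1) * ((r : ℕ) : ℤ))

/-- The Laplacian, transported to antisymmetric Laurent polynomials through multiplication by the
Vandermonde determinant; it is diagonal in the monomials. -/
noncomputable def laplace : Laurent N →ₗ[ℂ] Laurent N := diagOp fun μ => (casimir μ : ℂ)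

theorem casimir_permExp (σ : Equiv.Perm (Fin N)) : casimir (permExp σ) = 0 := by
  have := Equiv.sum_comp σ fun r : Fin N => (((r : ℕ) : ℤ) ^ 2 - (N - 1) * ((r : ℕ) : ℤ))
  simp only [casimir, permExp, this, sub_self]

theorem laplace_vand : laplace (vand N) = 0 := by
  simp [laplace, vand_eq_sum, map_sum, diagOp_single, casimir_permExp]

theorem laplace_eq (F : Laurent N) : laplace F = ∑ r, euler r (euler r F)
    - (N - 1 : ℂ) • ∑ r, euler r F
    - (∑ r : Fin N, (((r : ℕ) : ℂ) ^ 2 - (N - 1) * ((r : ℕ) : ℂ))) • F := by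
  ext μ
  simp only [laplace, euler_apply, coeff_diagOp, AddMonoidAlgebra.coeff_sub,
    AddMonoidAlgebra.coeff_sum, AddMonoidAlgebra.coeff_smul, Finsupp.sub_apply,
    Finsupp.finsetSum_apply, Finsupp.smul_apply, casimir, smul_eq_mul]
  push_cast
  simp only [Finset.sum_sub_distrib, Finset.sum_mul, Finset.mul_sum, sub_mul]
  simp only [pow_two, mul_assoc]

/-- As the Laplacian kills the Vandermonde determinant, only first-order terms of it survive. -/
theorem laplace_vand_mul (F : Laurent N) : laplace (vand N * F) =
    ∑ r, (vand N * euler r (euler r F) + 2 * euler r (vand N) * euler r F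
      - (N - 1) * vand N * euler r F) := by
  have h := laplace_eq (vand N)
  have h' := laplace_eq (vand N * F)
  generalize ∑ r : Fin N, (((r : ℕ) : ℂ) ^ 2 - (N - 1) * ((r : ℕ) : ℂ)) = c at h h'
  rw [laplace_vand] at h
  rw [h']
  simp only [Derivation.leibniz, map_add, smul_eq_mul, Finset.sum_add_distrib,
    Finset.sum_sub_distrib, ← Finset.mul_sum]
  simp only [Algebra.smul_def, map_sub, map_one, map_natCast] at h ⊢
  have hcomm : ∑ r, euler r F * euler r (vand N) = ∑ r, euler r (vand N) * euler r F :=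
    Finset.sum_congr rfl fun r _ => mul_comm _ _
  simp only [mul_assoc, ← Finset.mul_sum]
  linear_combination (-F) * h + hcomm

theorem evalPsum_X (k : ℤ) : evalPsum N (.X k) = psum N k := by simp [evalPsum]

theorem evalPsum_C (c : ℂ) : evalPsum N (.C c) = algebraMap ℂ _ c := by simp [evalPsum]

theorem evalPsum_loopDer (k : ℤ) (f : MvPolynomial ℤ ℂ) :
    evalPsum N (loopDer k f) = virasoro k (evalPsum N f) := by
  induction f using MvPolynomial.induction_on with
  | C a =>
    rw [evalPsum_C, Derivation.map_algebraMap, ← MvPolynomial.algebraMap_eq,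
      Derivation.map_algebraMap, map_zero]
  | add p q hp hq => simp only [map_add, hp, hq]
  | mul_X p n hp =>
    rw [Derivation.leibniz, map_mul, Derivation.leibniz, evalPsum_X, virasoro_psum]
    simp only [smul_eq_mul, map_add, map_mul, hp, evalPsum_X]
    simp only [loopDer, MvPolynomial.mkDerivation_X, map_smul, evalPsum_X]

/-- The chain rule for `z_r ∂/∂z_r` on polynomials in the power sums; any finite set of indices
containing those of the occurring power sums may be used. -/
theorem exists_euler_evalPsum (f : MvPolynomial ℤ ℂ) : ∃ s₀ : Finset ℤ, ∀ s, s₀ ⊆ s → ∀ r : Fin N,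
    euler r (evalPsum N f) =
      ∑ k ∈ s, x r k * evalPsum N ((k : ℂ) • MvPolynomial.pderiv k f) := by
  induction f using MvPolynomial.induction_on with
  | C a => exact ⟨∅, fun s _ r => by
    rw [evalPsum_C, Derivation.map_algebraMap]
    simp⟩
  | add p q hp hq =>
    obtain ⟨s, hs⟩ := hp
    obtain ⟨t, ht⟩ := hq
    refine ⟨s ∪ t, fun u hu r => ?_⟩
    rw [map_add, map_add, hs u (Finset.union_subset_left hu), ht u (Finset.union_subset_right hu),
      ← Finset.sum_add_distrib]
    exact Finset.sum_congr rfl fun k _ => by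
      rw [← mul_add, ← map_add (evalPsum N), ← smul_add, ← map_add (MvPolynomial.pderiv k)]
  | mul_X p n hp =>
    obtain ⟨s, hs⟩ := hp
    refine ⟨insert n s, fun u hu r => ?_⟩
    have hn : n ∈ u := hu (Finset.mem_insert_self _ _)
    rw [map_mul, Derivation.leibniz, hs u fun i hi => hu (Finset.mem_insert_of_mem hi), evalPsum_X]
    have h1 : euler r (psum N n) = (n : ℂ) • x r n := by simp [psum, euler_x]
    have h2 : ∀ k : ℤ, evalPsum N ((k : ℂ) • MvPolynomial.pderiv k (p * MvPolynomial.X n)) =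
        psum N n * evalPsum N ((k : ℂ) • MvPolynomial.pderiv k p) +
          if k = n then (n : ℂ) • evalPsum N p else 0 := by
      intro k
      rw [Derivation.leibniz, MvPolynomial.pderiv_X]
      rcases eq_or_ne k n with rfl | hkn
      · simp [evalPsum_X, add_comm]
      · simp [evalPsum_X, hkn]
    simp_rw [h2, mul_add, Finset.sum_add_distrib, h1]
    rw [add_comm]
    congr 1
    · rw [smul_eq_mul, Finset.mul_sum]
      exact Finset.sum_congr rfl fun k _ => by ring
    · simp [hn, mul_comm]

/-- On symmetric functions the Laplacian is a combination of the loop operators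
`g ↦ loopPoly k * g + loopDer k g`. -/
theorem exists_laplace_vand_mul (f : MvPolynomial ℤ ℂ) :
    ∃ (s : Finset ℤ) (h : ℤ → MvPolynomial ℤ ℂ), laplace (vand N * evalPsum N f) =
      vand N * evalPsum N (∑ k ∈ s, (loopPoly k * h k + loopDer k (h k))) := by
  obtain ⟨s, hs⟩ := exists_euler_evalPsum (N := N) f
  refine ⟨s, fun k => (k : ℂ) • MvPolynomial.pderiv k f, ?_⟩
  have h1 := hs s subset_rfl
  set G : ℤ → Laurent N := fun k => evalPsum N ((k : ℂ) • MvPolynomial.pderiv k f) with hG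
  rw [laplace_vand_mul, map_sum, Finset.mul_sum]
  have h2 : ∀ k, vand N * evalPsum N (loopPoly k * ((k : ℂ) • MvPolynomial.pderiv k f) +
      loopDer k ((k : ℂ) • MvPolynomial.pderiv k f)) =
      ∑ r, (2 * euler r (vand N) * (x r k * G k) - (N - 1) * vand N * (x r k * G k) +
        vand N * (k * x r k * G k + x r k * euler r (G k))) := by
    intro k
    rw [map_add, map_mul, evalPsum_loopDer, mul_add, ← mul_assoc, ← virasoro_vand_loopPoly]
    simp only [virasoro_apply, psum, Finset.mul_sum, Finset.sum_mul, ← Finset.sum_add_distrib,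
      ← Finset.sum_sub_distrib]
    exact Finset.sum_congr rfl fun r _ => by ring
  simp_rw [h2]
  rw [Finset.sum_comm]
  refine Finset.sum_congr rfl fun r _ => ?_
  change ∀ r, _ = ∑ k ∈ s, x r k * G k at h1
  clear_value G
  simp only [h1, map_sum, Derivation.leibniz, euler_x, if_true, Finset.mul_sum,
    ← Finset.sum_add_distrib, ← Finset.sum_sub_distrib]
  refine Finset.sum_congr rfl fun k _ => ?_
  simp only [smul_eq_mul, Algebra.smul_def, map_intCast]
  ring

/-! ### Antisymmetry -/

/-- Permutation of the variables, on the level of exponents `μ ↦ μ ∘ τ`. -/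
noncomputable def permute (τ : Equiv.Perm (Fin N)) : Laurent N →ₐ[ℂ] Laurent N :=
  (AddMonoidAlgebra.domCongr ℂ ℂ (LinearEquiv.funCongrLeft ℤ ℤ τ).toAddEquiv).toAlgHom

theorem coeff_permute (τ : Equiv.Perm (Fin N)) (F : Laurent N) (μ : Fin N → ℤ) :
    (permute τ F).coeff (μ ∘ τ) = F.coeff μ := by
  have := AddMonoidAlgebra.coeff_domCongr (R := ℂ) (A := ℂ)
    (LinearEquiv.funCongrLeft ℤ ℤ τ).toAddEquiv F (μ ∘ τ)
  refine this.trans ?_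
  congr 1
  exact (LinearEquiv.funCongrLeft ℤ ℤ τ).symm_apply_apply μ

theorem permute_x (τ : Equiv.Perm (Fin N)) (r : Fin N) (k : ℤ) :
    permute τ (x r k) = x (τ.symm r) k := by
  have h : permute τ (x r k) = .single (Pi.single r k ∘ τ) 1 := by
    change AddMonoidAlgebra.domCongr ℂ ℂ _ (AddMonoidAlgebra.single _ _) = _
    rw [AddMonoidAlgebra.domCongr_single]
    rfl
  rw [h, x]
  congr 1
  ext i
  simp [Pi.single_apply, Equiv.eq_symm_apply]

theorem permute_evalPsum (τ : Equiv.Perm (Fin N)) (f : MvPolynomial ℤ ℂ) :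
    permute τ (evalPsum N f) = evalPsum N f := by
  have : (permute τ).comp (evalPsum N) = evalPsum N := by
    ext k
    simp only [AlgHom.comp_apply, evalPsum_X, psum, map_sum, permute_x]
    rw [Equiv.sum_comp τ.symm fun i => x i k]
  exact DFunLike.congr_fun this f

theorem permute_vand (τ : Equiv.Perm (Fin N)) :
    permute τ (vand N) = ((Equiv.Perm.sign τ : ℤ) : Laurent N) * vand N := by
  rw [vand, AlgHom.map_det, ← Equiv.Perm.sign_symm, ← Matrix.det_permute]
  congr 1
  ext i j : 2
  simp [Matrix.vandermonde_apply, permute_x]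

/-- `vand * f` is antisymmetric for a symmetric `f`. -/
theorem coeff_comp_perm (f : MvPolynomial ℤ ℂ) (τ : Equiv.Perm (Fin N)) (μ : Fin N → ℤ) :
    (vand N * evalPsum N f).coeff (μ ∘ τ) =
      ((Equiv.Perm.sign τ : ℤ) : ℂ) * (vand N * evalPsum N f).coeff μ := by
  rw [← coeff_permute τ (vand N * evalPsum N f) μ, map_mul, permute_evalPsum, permute_vand]
  rcases Int.units_eq_one_or (Equiv.Perm.sign τ) with h | h <;> simp [h]

theorem coeff_eq_zero_of_not_injective (f : MvPolynomial ℤ ℂ) (μ : Fin N → ℤ)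
    (hμ : ¬ Function.Injective μ) : (vand N * evalPsum N f).coeff μ = 0 := by
  simp only [Function.Injective, not_forall] at hμ
  obtain ⟨i, j, h, hij⟩ := hμ
  have h1 : μ ∘ Equiv.swap i j = μ := by
    ext r
    simp only [Function.comp_apply, Equiv.swap_apply_def]
    split_ifs with h2 h3
    · rw [h2, h]
    · rw [h3, h]
    · rfl
  have h2 := coeff_comp_perm f (Equiv.swap i j) μ
  rw [h1, Equiv.Perm.sign_swap hij] at h2
  simp only [Units.val_neg, Units.val_one, Int.cast_neg, Int.cast_one, neg_mul, one_mul] at h2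
  exact self_eq_neg.1 h2

/-- Among exponents with distinct entries, the Laplacian has the eigenvalue `0` only at the
rearrangements of `(0, …, N - 1)`: outside `{0, …, N - 1}` the function `a (a - (N - 1))` is
positive, and inside it is nonpositive. -/
theorem exists_eq_permExp (μ : Fin N → ℤ) (hμ : Function.Injective μ) (h : casimir μ = 0) :
    ∃ σ, μ = permExp σ := by
  classical
  set v : ℤ → ℤ := fun a => a ^ 2 - (N - 1) * a with hv
  set S : Finset ℤ := Finset.univ.image μ with hS
  set A : Finset ℤ := Finset.univ.image fun r : Fin N => ((r : ℕ) : ℤ) with hA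
  have hAmem : ∀ a : ℤ, a ∈ A ↔ 0 ≤ a ∧ a < N := by
    intro a
    simp only [hA, Finset.mem_image, Finset.mem_univ, true_and]
    constructor
    · rintro ⟨r, rfl⟩; omega
    · rintro ⟨h0, h1⟩; exact ⟨⟨a.toNat, by omega⟩, by simp [h0]⟩
  have h1 : ∑ a ∈ S, v a = ∑ a ∈ A, v a := by
    rw [hS, hA, Finset.sum_image fun i _ j _ hij => hμ hij, Finset.sum_image]
    · exact sub_eq_zero.1 h
    · intro i _ j _ hij
      ext; simpa using hij
  have h2 : ∑ a ∈ S \ A, v a = ∑ a ∈ A \ S, v a := by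
    have := Finset.sum_sdiff_sub_sum_sdiff (s₁ := S) (s₂ := A) (f := v)
    rw [h1, sub_self] at this
    linarith
  have h3 : ∑ a ∈ A \ S, v a ≤ 0 := by
    refine Finset.sum_nonpos fun a ha => ?_
    have := (hAmem a).1 (Finset.mem_sdiff.1 ha).1
    simp only [hv]
    nlinarith [this.1, this.2]
  have h4 : S \ A = ∅ := by
    by_contra hne
    have : 0 < ∑ a ∈ S \ A, v a := by
      refine Finset.sum_pos (fun a ha => ?_) (Finset.nonempty_iff_ne_empty.2 hne)
      have h5 := (hAmem a).not.1 (Finset.mem_sdiff.1 ha).2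
      obtain ⟨i, -, -⟩ := Finset.mem_image.1 (Finset.mem_sdiff.1 ha).1
      have hN : 1 ≤ N := i.pos
      simp only [hv]
      rcases lt_or_ge a 0 with h6 | h6
      · nlinarith
      · have h7 : (N : ℤ) ≤ a := by omega
        nlinarith
    omega
  have h5 : ∀ r, 0 ≤ μ r ∧ μ r < N := fun r =>
    (hAmem _).1 (Finset.sdiff_eq_empty_iff_subset.1 h4 (Finset.mem_image_of_mem μ
      (Finset.mem_univ r)))
  let e : Fin N → Fin N := fun r => ⟨(μ r).toNat, by have := h5 r; omega⟩
  have he : Function.Injective e := by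
    intro i j hij
    have := Fin.ext_iff.1 hij
    simp only [e] at this
    have hi := h5 i; have hj := h5 j
    exact hμ (by omega)
  refine ⟨Equiv.ofBijective e (Finite.injective_iff_bijective.1 he), ?_⟩
  ext r
  have := h5 r
  simp [permExp, e, this.1]

/-! ### The Weyl functional -/

/-- Integration of the symmetric function `f` against the Weyl density `|vand| ^ 2 / N!`, written
as a constant term: the pairing of `vand * f` with the Vandermonde determinant. -/
noncomputable def weyl (N : ℕ) (f : MvPolynomial ℤ ℂ) : ℂ :=
  (N.factorial : ℂ)⁻¹ * ∑ σ : Equiv.Perm (Fin N), ((Equiv.Perm.sign σ : ℤ) : ℂ) *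
    (vand N * evalPsum N f).coeff (permExp σ)

/-- A functional on polynomials in the power sums that is annihilated by the loop operators, and
sends constants to themselves, is the Weyl functional. The loop operators make it vanish on the
range of the Laplacian, and the other eigencomponents of `vand * f` can be removed by applying
`laplace - c`, leaving a multiple of the Vandermonde determinant. -/
theorem eq_weyl_of_loop (ℓ : MvPolynomial ℤ ℂ →ₗ[ℂ] ℂ)
    (hloop : ∀ k g, ℓ (loopPoly k * g + loopDer k g) = 0)
    (hconst : ∀ f c, evalPsum N f = algebraMap ℂ _ c → ℓ f = c) (f : MvPolynomial ℤ ℂ) :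
    ℓ f = weyl N f := by
  classical
  -- `g` is `f` with `laplace - c` applied for each `c ∈ C`; modulo `ker ℓ` it is a multiple of `f`
  have key : ∀ C : Finset ℤ, ∃ g, ℓ g = (∏ c ∈ C, (-(c : ℂ))) * ℓ f ∧
      ∀ μ, (vand N * evalPsum N g).coeff μ =
        (∏ c ∈ C, ((casimir μ : ℂ) - c)) * (vand N * evalPsum N f).coeff μ := by
    intro C
    induction C using Finset.induction_on with
    | empty => exact ⟨f, by simp⟩
    | insert c C hc ih =>
      obtain ⟨g, hg, hgμ⟩ := ih
      obtain ⟨s, h, hL⟩ := exists_laplace_vand_mul (N := N) g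
      refine ⟨∑ k ∈ s, (loopPoly k * h k + loopDer k (h k)) - (c : ℂ) • g, ?_, fun μ => ?_⟩
      · rw [map_sub, map_sum, Finset.sum_eq_zero fun k _ => hloop k (h k), map_smul, hg,
          Finset.prod_insert hc, smul_eq_mul]
        ring
      · rw [map_sub, mul_sub, ← hL, map_smul, mul_smul_comm, AddMonoidAlgebra.coeff_sub,
          AddMonoidAlgebra.coeff_smul, Finsupp.sub_apply, Finsupp.smul_apply, laplace,
          coeff_diagOp, hgμ, Finset.prod_insert hc, smul_eq_mul]
        ring
  set C : Finset ℤ := ((vand N * evalPsum N f).coeff.support.image casimir).erase 0 with hC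
  obtain ⟨g, hg, hgμ⟩ := key C
  have hC0 : (∏ c ∈ C, (-(c : ℂ))) ≠ 0 := by
    refine Finset.prod_ne_zero_iff.2 fun c hc => ?_
    simpa using (Finset.mem_erase.1 hc).1
  set a := (vand N * evalPsum N g).coeff (permExp 1) with ha
  have hperm : ∀ σ : Equiv.Perm (Fin N), permExp (N := N) 1 ∘ σ = permExp σ := fun σ => rfl
  have hconst' : vand N * evalPsum N g = a • vand N := by
    ext μ
    rw [AddMonoidAlgebra.coeff_smul, Finsupp.smul_apply, smul_eq_mul]
    by_cases hμ : ∃ σ, μ = permExp σ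
    · obtain ⟨σ, rfl⟩ := hμ
      rw [coeff_vand_permExp, ← hperm σ, coeff_comp_perm, mul_comm]
    · have h0 : (vand N).coeff μ = 0 := by
        rw [vand_eq_sum, AddMonoidAlgebra.coeff_sum, Finsupp.finsetSum_apply]
        refine Finset.sum_eq_zero fun σ _ => ?_
        rw [AddMonoidAlgebra.coeff_single, Finsupp.single_apply,
          if_neg fun h => hμ ⟨σ, h.symm⟩]
      rw [h0, mul_zero]
      by_cases hinj : Function.Injective μ
      · rw [hgμ]
        by_cases hf : (vand N * evalPsum N f).coeff μ = 0
        · rw [hf, mul_zero]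
        · have hcas : casimir μ ≠ 0 := fun h => hμ (exists_eq_permExp μ hinj h)
          have hmem : casimir μ ∈ C := Finset.mem_erase.2
            ⟨hcas, Finset.mem_image_of_mem _ (Finsupp.mem_support_iff.2 hf)⟩
          rw [Finset.prod_eq_zero (f := fun c : ℤ => (casimir μ : ℂ) - c) hmem (sub_self _),
            zero_mul]
      · exact coeff_eq_zero_of_not_injective g μ hinj
  have hga : evalPsum N g = algebraMap ℂ _ a := by
    refine mul_left_cancel₀ (vand_ne_zero (N := N)) ?_
    rw [hconst', Algebra.smul_def, mul_comm]
  have h1 := hconst g a hga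
  have h2 : weyl N g = a := by
    rw [weyl]
    have : ∀ σ : Equiv.Perm (Fin N), ((Equiv.Perm.sign σ : ℤ) : ℂ) *
        (vand N * evalPsum N g).coeff (permExp σ) = a := by
      intro σ
      rw [← hperm σ, coeff_comp_perm, ← ha, ← mul_assoc]
      rcases Int.units_eq_one_or (Equiv.Perm.sign σ) with h | h <;> simp [h]
    simp_rw [this]
    rw [Finset.sum_const, Finset.card_univ, Fintype.card_perm, Fintype.card_fin, nsmul_eq_mul,
      inv_mul_cancel_left₀]
    exact_mod_cast N.factorial_ne_zero
  have h3 : weyl N g = (∏ c ∈ C, (-(c : ℂ))) * weyl N f := by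
    simp only [weyl, hgμ, casimir_permExp, Int.cast_zero, zero_sub]
    simp only [Finset.mul_sum]
    exact Finset.sum_congr rfl fun σ _ => by ring
  refine mul_left_cancel₀ hC0 ?_
  rw [← hg, ← h3, h1, h2]

end Laurent

variable {N : ℕ}

/-! ### Integration by parts on the unitary group -/

/-- The one-parameter subgroup `t ↦ exp (t X)` of `U(N)` for a skew-Hermitian matrix `X`. -/
noncomputable def oneParam (X : skewAdjoint (Matrix (Fin N) (Fin N) ℂ)) (t : ℝ) : UN N :=
  ⟨NormedSpace.exp (t • (X : Matrix (Fin N) (Fin N) ℂ)), by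
    have hX : ((X : Matrix (Fin N) (Fin N) ℂ)).conjTranspose = -X := X.2
    rw [Matrix.mem_unitaryGroup_iff, Matrix.star_eq_conjTranspose, ← Matrix.exp_conjTranspose,
      Matrix.conjTranspose_smul, hX, star_trivial, smul_neg,
      ← Matrix.exp_add_of_commute _ _
        (Commute.refl (t • (X : Matrix (Fin N) (Fin N) ℂ))).neg_right, add_neg_cancel,
      NormedSpace.exp_zero]⟩

theorem oneParam_add (X : skewAdjoint (Matrix (Fin N) (Fin N) ℂ)) (s t : ℝ) :
    oneParam X (s + t) = oneParam X s * oneParam X t := by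
  apply Subtype.ext
  change NormedSpace.exp _ = NormedSpace.exp _ * NormedSpace.exp _
  rw [add_smul, Matrix.exp_add_of_commute]
  exact ((Commute.refl _).smul_left _).smul_right _

theorem oneParam_zero (X : skewAdjoint (Matrix (Fin N) (Fin N) ℂ)) : oneParam X 0 = 1 := by
  apply Subtype.ext
  change NormedSpace.exp _ = 1
  rw [zero_smul, NormedSpace.exp_zero]

open scoped Matrix.Norms.Operator in
theorem hasDerivAt_oneParam (X : skewAdjoint (Matrix (Fin N) (Fin N) ℂ)) (i j : Fin N) :
    HasDerivAt (fun t : ℝ => (oneParam X t : Matrix (Fin N) (Fin N) ℂ) i j)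
      ((X : Matrix (Fin N) (Fin N) ℂ) i j) 0 := by
  have h := hasDerivAt_exp_smul_const (𝕂 := ℝ) (X : Matrix (Fin N) (Fin N) ℂ) 0
  rw [zero_smul, NormedSpace.exp_zero, one_mul] at h
  let e : Matrix (Fin N) (Fin N) ℂ →L[ℝ] ℂ :=
    ⟨⟨⟨fun M => M i j, fun _ _ => rfl⟩, fun _ _ => rfl⟩, continuous_id.matrix_elem i j⟩
  exact e.hasFDerivAt.comp_hasDerivAt 0 h

/-- `G` is a gradient of `Φ` for left translations: the derivative of `Φ` at `A` along
`exp (t X) A` is `tr (G A · X)`. -/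
def HasGrad (Φ : UN N → ℂ) (G : UN N → Matrix (Fin N) (Fin N) ℂ) : Prop :=
  ∀ (X : skewAdjoint (Matrix (Fin N) (Fin N) ℂ)) (A : UN N),
    HasDerivAt (fun t : ℝ => Φ (oneParam X t * A))
      (G A * (X : Matrix (Fin N) (Fin N) ℂ)).trace 0

theorem HasGrad.add {Φ Ψ : UN N → ℂ} {G H : UN N → Matrix (Fin N) (Fin N) ℂ} (h : HasGrad Φ G)
    (h' : HasGrad Ψ H) : HasGrad (fun A => Φ A + Ψ A) (fun A => G A + H A) := fun X A => by
  simp only [add_mul, Matrix.trace_add]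
  exact (h X A).add (h' X A)

theorem HasGrad.mul {Φ Ψ : UN N → ℂ} {G H : UN N → Matrix (Fin N) (Fin N) ℂ} (h : HasGrad Φ G)
    (h' : HasGrad Ψ H) : HasGrad (fun A => Φ A * Ψ A) (fun A => Ψ A • G A + Φ A • H A) :=
  fun X A => by
    have := (h X A).mul (h' X A)
    simp only [oneParam_zero, one_mul] at this
    refine this.congr_deriv ?_
    simp only [add_mul, Matrix.smul_mul, Matrix.trace_add, Matrix.trace_smul, smul_eq_mul]
    ring

theorem HasGrad.const (c : ℂ) : HasGrad (fun _ : UN N => c) 0 := fun X A => by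
  simpa using hasDerivAt_const (0 : ℝ) c

theorem HasGrad.sum {ι : Type*} (s : Finset ι) {Φ : ι → UN N → ℂ}
    {G : ι → UN N → Matrix (Fin N) (Fin N) ℂ} (h : ∀ i ∈ s, HasGrad (Φ i) (G i)) :
    HasGrad (fun A => ∑ i ∈ s, Φ i A) (fun A => ∑ i ∈ s, G i A) := fun X A => by
  simpa [Finset.sum_mul, Matrix.trace_sum] using HasDerivAt.fun_sum fun i hi => h i hi X A

instance isHaarMeasure_haarUN : (haarUN N).IsHaarMeasure := by
  unfold haarUN; infer_instance

instance isProbabilityMeasure_haarUN : IsProbabilityMeasure (haarUN N) :=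
  ⟨by simpa [haarUN] using
    Measure.haarMeasure_self (K₀ := (⊤ : TopologicalSpace.PositiveCompacts (UN N)))⟩

theorem integrable_of_continuous {Φ : UN N → ℂ} (h : Continuous Φ) : Integrable Φ (haarUN N) :=
  h.integrable_of_hasCompactSupport (HasCompactSupport.of_compactSpace _)

/-- Differentiation of the constant function `t ↦ ∫ Φ (exp (t X) A)` under the integral sign. -/
theorem HasGrad.integral_trace_eq_zero {Φ : UN N → ℂ} {G : UN N → Matrix (Fin N) (Fin N) ℂ}
    (h : HasGrad Φ G) (hΦ : Continuous Φ) (hG : Continuous G)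
    (X : skewAdjoint (Matrix (Fin N) (Fin N) ℂ)) :
    ∫ A, (G A * (X : Matrix (Fin N) (Fin N) ℂ)).trace ∂(haarUN N) = 0 := by
  have hc : Continuous fun A : UN N => (G A * (X : Matrix (Fin N) (Fin N) ℂ)).trace :=
    (hG.matrix_mul continuous_const).matrix_trace
  obtain ⟨C, hC⟩ := (isCompact_univ (X := UN N)).exists_bound_of_continuousOn hc.continuousOn
  have hderiv : ∀ A : UN N, ∀ t : ℝ, HasDerivAt (fun t : ℝ => Φ (oneParam X t * A))
      (G (oneParam X t * A) * (X : Matrix (Fin N) (Fin N) ℂ)).trace t := by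
    intro A t
    have h1 := h X (oneParam X t * A)
    have h2 : (fun s : ℝ => Φ (oneParam X s * A)) =
        fun s : ℝ => Φ (oneParam X (s - t) * (oneParam X t * A)) := by
      ext s
      rw [← mul_assoc, ← oneParam_add, sub_add_cancel]
    rw [h2]
    have h3 : HasDerivAt (fun s : ℝ => Φ (oneParam X s * (oneParam X t * A)))
      (G (oneParam X t * A) * (X : Matrix (Fin N) (Fin N) ℂ)).trace (t - t) := by
      rwa [sub_self]
    exact h3.comp_sub_const t t
  have key := hasDerivAt_integral_of_dominated_loc_of_deriv_le (μ := haarUN N)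
    (F := fun t A => Φ (oneParam X t * A))
    (F' := fun t A => (G (oneParam X t * A) * (X : Matrix (Fin N) (Fin N) ℂ)).trace)
    (x₀ := (0 : ℝ)) (bound := fun _ => C) (s := Set.univ) Filter.univ_mem
    (Eventually.of_forall fun t => (hΦ.comp (continuous_const_mul _)).aestronglyMeasurable)
    (integrable_of_continuous (hΦ.comp (continuous_const_mul _)))
    (hc.comp (continuous_const_mul _)).aestronglyMeasurable
    (Eventually.of_forall fun A t _ => hC _ (Set.mem_univ _)) (integrable_const C)
    (Eventually.of_forall fun A t _ => hderiv A t)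
  have h4 : (fun t : ℝ => ∫ A, Φ (oneParam X t * A) ∂(haarUN N)) =
      fun _ => ∫ A, Φ A ∂(haarUN N) := by
    ext t
    exact integral_mul_left_eq_self Φ (oneParam X t)
  have h5 := key.2
  rw [h4] at h5
  simpa [oneParam_zero] using h5.unique (hasDerivAt_const (0 : ℝ) _)

/-- Invariance of Haar measure: gradients have mean zero. Complex matrices are complex
combinations of skew-Hermitian ones. -/
theorem HasGrad.integral_eq_zero {Φ : UN N → ℂ} {G : UN N → Matrix (Fin N) (Fin N) ℂ}
    (h : HasGrad Φ G) (hΦ : Continuous Φ) (hG : Continuous G) (i j : Fin N) :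
    ∫ A, G A i j ∂(haarUN N) = 0 := by
  have hint : ∀ M : Matrix (Fin N) (Fin N) ℂ,
      Integrable (fun A => (G A * M).trace) (haarUN N) := fun M =>
    integrable_of_continuous (hG.matrix_mul continuous_const).matrix_trace
  set M : Matrix (Fin N) (Fin N) ℂ := Matrix.single j i 1 with hM
  have h1 : M - M.conjTranspose ∈ skewAdjoint (Matrix (Fin N) (Fin N) ℂ) := by
    rw [skewAdjoint.mem_iff, Matrix.star_eq_conjTranspose]; simp
  have h2 : Complex.I • (M + M.conjTranspose) ∈ skewAdjoint (Matrix (Fin N) (Fin N) ℂ) := by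
    rw [skewAdjoint.mem_iff, Matrix.star_eq_conjTranspose]; simp [add_comm]
  have e1 := h.integral_trace_eq_zero hΦ hG ⟨_, h1⟩
  have e2 := h.integral_trace_eq_zero hΦ hG ⟨_, h2⟩
  have e3 : ∀ A : UN N, G A i j = (1 / 2 : ℂ) * (G A * (M - M.conjTranspose)).trace
      + (1 / 2 * -Complex.I) * (G A * (Complex.I • (M + M.conjTranspose))).trace := by
    intro A
    have : G A i j = (G A * M).trace := by simp [hM, Matrix.trace_mul_single]
    rw [this, Matrix.mul_smul, Matrix.trace_smul, mul_sub, mul_add, Matrix.trace_sub,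
      Matrix.trace_add, smul_eq_mul]
    linear_combination (1 / 2 : ℂ) * ((G A * M).trace + (G A * M.conjTranspose).trace) *
      Complex.I_mul_I
  simp_rw [e3]
  rw [integral_add ((hint _).const_mul _) ((hint _).const_mul _), integral_const_mul,
    integral_const_mul]
  simp only at e1 e2
  rw [e1, e2]
  simp

/-! ### The loop equations -/

/-- The integer power `A ^ k` as a matrix. -/
noncomputable def zpowM (A : UN N) (k : ℤ) : Matrix (Fin N) (Fin N) ℂ := ((A ^ k : UN N) :)

theorem zpowM_add (A : UN N) (k l : ℤ) : zpowM A (k + l) = zpowM A k * zpowM A l := by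
  rw [zpowM, zpow_add]; rfl

theorem zpowM_neg (A : UN N) (k : ℤ) : zpowM A (-k) = (zpowM A k).conjTranspose := by
  rw [zpowM, zpow_neg]; rfl

theorem zpowM_zero (A : UN N) : zpowM A 0 = 1 := by
  rw [zpowM, zpow_zero]; rfl

theorem zpowM_one (A : UN N) : zpowM A 1 = A := by
  rw [zpowM, zpow_one]

theorem continuous_zpowM (k : ℤ) : Continuous fun A : UN N => zpowM A k :=
  continuous_subtype_val.comp (continuous_zpow k)

/-- The derivative of `A ^ k` along `exp (t X) A`, by the Leibniz rule. -/
noncomputable def zpowDeriv (A : UN N) (X : Matrix (Fin N) (Fin N) ℂ) :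
    ℤ → Matrix (Fin N) (Fin N) ℂ
  | .ofNat n => ∑ i ∈ Finset.range n, zpowM A (n - (i + 1)) * X * zpowM A (i + 1)
  | .negSucc m => -∑ i ∈ Finset.range (m + 1), zpowM A (-(m + 1 - i)) * X * zpowM A (-i)

theorem hasDerivAt_natPow (X : skewAdjoint (Matrix (Fin N) (Fin N) ℂ)) (A : UN N) (n : ℕ)
    (a b : Fin N) : HasDerivAt (fun t : ℝ => zpowM (oneParam X t * A) n a b)
      (zpowDeriv A X (.ofNat n) a b) 0 := by
  induction n generalizing a b with
  | zero =>
    simp only [Nat.cast_zero, zpowM_zero, zpowDeriv, Finset.range_zero, Finset.sum_empty]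
    exact hasDerivAt_const (0 : ℝ) _
  | succ n ih =>
    have h1 : ∀ c, HasDerivAt (fun t : ℝ => zpowM (oneParam X t * A) 1 c b)
        (((X : Matrix (Fin N) (Fin N) ℂ) * zpowM A 1) c b) 0 := by
      intro c
      simp only [zpowM_one]
      change HasDerivAt (fun t : ℝ => ∑ d, (oneParam X t : Matrix (Fin N) (Fin N) ℂ) c d *
        (A : Matrix (Fin N) (Fin N) ℂ) d b) (∑ d, _) 0
      exact HasDerivAt.fun_sum fun d _ => (hasDerivAt_oneParam X c d).mul_const _
    have h2 : (fun t : ℝ => zpowM (oneParam X t * A) ((n + 1 : ℕ) : ℤ) a b) = fun t : ℝ =>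
        ∑ c, zpowM (oneParam X t * A) n a c * zpowM (oneParam X t * A) 1 c b := by
      ext t
      rw [Nat.cast_succ, zpowM_add, Matrix.mul_apply]
    rw [h2]
    refine (HasDerivAt.fun_sum fun c _ => (ih a c).mul (h1 c)).congr_deriv ?_
    simp only [oneParam_zero, one_mul, Finset.sum_add_distrib, ← Matrix.mul_apply]
    rw [← Matrix.add_apply]
    simp only [zpowDeriv]
    rw [Finset.sum_range_succ', Finset.sum_mul]
    refine congrArg (fun P : Matrix (Fin N) (Fin N) ℂ => P a b)
      (congrArg₂ (fun P Q : Matrix (Fin N) (Fin N) ℂ => P + Q) ?_ ?_)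
    · refine Finset.sum_congr rfl fun i _ => ?_
      rw [mul_assoc _ _ (zpowM A 1), ← zpowM_add]
      have h3 : (((n + 1 : ℕ) : ℤ) - (((i + 1 : ℕ) : ℤ) + 1)) = n - (i + 1) := by
        push_cast; ring
      rw [h3, Nat.cast_succ]
    · rw [← mul_assoc]
      simp

theorem hasDerivAt_zpowM (X : skewAdjoint (Matrix (Fin N) (Fin N) ℂ)) (A : UN N) (k : ℤ)
    (a b : Fin N) : HasDerivAt (fun t : ℝ => zpowM (oneParam X t * A) k a b)
      (zpowDeriv A X k a b) 0 := by
  cases k with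
  | ofNat n => exact hasDerivAt_natPow X A n a b
  | negSucc m =>
    have h := (hasDerivAt_natPow X A (m + 1) b a).star
    have h1 : (fun t : ℝ => zpowM (oneParam X t * A) (Int.negSucc m) a b) =
        fun t : ℝ => star (zpowM (oneParam X t * A) ((m + 1 : ℕ) : ℤ) b a) := by
      ext t
      rw [Int.negSucc_eq, zpowM_neg]
      rfl
    rw [h1]
    refine h.congr_deriv ?_
    have hX : ((X : Matrix (Fin N) (Fin N) ℂ)).conjTranspose = -X := X.2
    change (zpowDeriv A X (Int.ofNat (m + 1))).conjTranspose a b = _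
    suffices h2 : (zpowDeriv A X (Int.ofNat (m + 1))).conjTranspose = zpowDeriv A X (.negSucc m) by
      rw [h2]
    simp only [zpowDeriv]
    rw [Matrix.conjTranspose_sum, ← Finset.sum_neg_distrib,
      ← Finset.sum_range_reflect (n := m + 1)]
    refine Finset.sum_congr rfl fun i hi => ?_
    have := Finset.mem_range.1 hi
    rw [Matrix.conjTranspose_mul, Matrix.conjTranspose_mul, hX, ← zpowM_neg, ← zpowM_neg,
      mul_assoc, neg_mul, mul_neg]
    have e1 : (((m + 1 - 1 - i : ℕ) : ℤ) + 1) = m + 1 - i := by omega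
    have e2 : (((m + 1 : ℕ) : ℤ) - (m + 1 - i)) = i := by push_cast; ring
    rw [e1, e2]

/-- The gradient of the matrix entry `(A ^ k) a b`, in the sense of `HasGrad`. -/
noncomputable def entryGrad (k : ℤ) (a b : Fin N) (A : UN N) : Matrix (Fin N) (Fin N) ℂ :=
  match k with
  | .ofNat n => ∑ i ∈ Finset.range n,
      zpowM A (i + 1) * Matrix.single b a 1 * zpowM A (n - (i + 1))
  | .negSucc m => -∑ i ∈ Finset.range (m + 1),
      zpowM A (-i) * Matrix.single b a 1 * zpowM A (-(m + 1 - i))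

theorem trace_single_mul_mul (P Q X : Matrix (Fin N) (Fin N) ℂ) (a b : Fin N) :
    (Q * Matrix.single b a 1 * P * X).trace = (P * X * Q) a b := by
  rw [mul_assoc Q, mul_assoc Q, Matrix.trace_mul_comm, mul_assoc, mul_assoc]
  rw [Matrix.trace_single_mul]
  simp [mul_assoc]

theorem hasGrad_zpowM (k : ℤ) (a b : Fin N) :
    HasGrad (fun A : UN N => zpowM A k a b) (entryGrad k a b) := fun X A => by
  refine (hasDerivAt_zpowM X A k a b).congr_deriv ?_
  cases k with
  | ofNat n =>
    simp only [zpowDeriv, entryGrad, Finset.sum_mul, Matrix.trace_sum, trace_single_mul_mul]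
    simp [Matrix.sum_apply]
  | negSucc m =>
    simp only [zpowDeriv, entryGrad, neg_mul, Finset.sum_mul, Matrix.trace_neg, Matrix.trace_sum,
      trace_single_mul_mul]
    simp [Matrix.sum_apply]

theorem continuous_entryGrad (k : ℤ) (a b : Fin N) :
    Continuous (entryGrad k a b : UN N → Matrix (Fin N) (Fin N) ℂ) := by
  have h := fun l : ℤ => continuous_zpowM (N := N) l
  cases k with
  | ofNat n =>
    exact continuous_finsetSum _ fun i _ =>
      ((h _).matrix_mul continuous_const).matrix_mul (h _)
  | negSucc m =>
    exact (continuous_finsetSum _ fun i _ =>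
      ((h _).matrix_mul continuous_const).matrix_mul (h _)).neg

/-- The power sums `tr A ^ k` of a unitary matrix. -/
noncomputable def tracePow (A : UN N) (k : ℤ) : ℂ := (zpowM A k).trace

/-- Substitution of the power sums `tr A ^ k` for the indeterminates `X_k`, `k ∈ ℤ`. -/
noncomputable def evalTrace (A : UN N) : MvPolynomial ℤ ℂ →ₐ[ℂ] ℂ :=
  MvPolynomial.aeval (tracePow A)

theorem evalTrace_X (A : UN N) (k : ℤ) : evalTrace A (.X k) = tracePow A k := by simp [evalTrace]

theorem continuous_tracePow (k : ℤ) : Continuous fun A : UN N => tracePow A k :=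
  (continuous_zpowM k).matrix_trace

theorem continuous_evalTrace (f : MvPolynomial ℤ ℂ) : Continuous fun A : UN N => evalTrace A f := by
  induction f using MvPolynomial.induction_on with
  | C a => simpa [evalTrace] using continuous_const
  | add p q hp hq => simp only [map_add]; exact hp.add hq
  | mul_X p n hp => simp only [map_mul, evalTrace_X]; exact hp.mul (continuous_tracePow n)

/-- The derivatives of the factor `(A ^ k) a b` produce the contraction term. -/
theorem sum_entryGrad (k : ℤ) (A : UN N) :
    ∑ a, ∑ b, entryGrad k a b A b a = evalTrace A (loopPoly k) := by
  have h : ∀ p q : ℤ, ∑ a : Fin N, ∑ b : Fin N,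
      (zpowM A p * Matrix.single b a (1 : ℂ) * zpowM A q) b a = tracePow A p * tracePow A q := by
    intro p q
    have : ∀ a b : Fin N, (zpowM A p * Matrix.single b a (1 : ℂ) * zpowM A q) b a =
        zpowM A p b b * zpowM A q a a := by
      intro a b
      have := trace_single_mul_mul (N := N) (zpowM A q) (zpowM A p) (Matrix.single a b 1) a b
      rw [Matrix.trace_mul_single] at this
      simp only [MulOpposite.op_one, one_smul] at this
      rw [this, Matrix.mul_assoc, Matrix.mul_apply, Finset.sum_eq_single a]
      · simp [mul_comm]
      · intro c _ hc
        simp [Matrix.single_mul_apply_of_ne, hc]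
      · simp
    simp only [this, tracePow, Matrix.trace, Matrix.diag, Finset.sum_mul_sum]
    rw [Finset.sum_comm]
  cases k with
  | ofNat n =>
    simp only [entryGrad, loopPoly, Matrix.sum_apply, map_sum, map_mul, evalTrace_X]
    simp_rw [Finset.sum_comm (s := (Finset.univ : Finset (Fin N))) (t := Finset.range _)]
    exact Finset.sum_congr rfl fun i _ => h _ _
  | negSucc m =>
    simp only [entryGrad, loopPoly, Matrix.neg_apply, Matrix.sum_apply, map_neg, map_sum, map_mul,
      evalTrace_X, Finset.sum_neg_distrib]
    simp_rw [Finset.sum_comm (s := (Finset.univ : Finset (Fin N))) (t := Finset.range _)]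
    exact congrArg _ (Finset.sum_congr rfl fun i _ => h _ _)

theorem sum_trace_entryGrad (k : ℤ) (A : UN N) :
    ∑ a, entryGrad k a a A = (k : ℂ) • zpowM A k := by
  have h : ∀ p q : ℤ, ∑ a, (zpowM A p * Matrix.single a a 1 * zpowM A q) = zpowM A (p + q) := by
    intro p q
    have h1 : ∑ a : Fin N, Matrix.single a a (1 : ℂ) = 1 := by
      ext i j
      rw [Matrix.sum_apply]
      rcases eq_or_ne i j with rfl | h
      · simp [Matrix.single_apply]
      · refine (Finset.sum_eq_zero fun a _ => ?_).trans (Matrix.one_apply_ne h).symm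
        exact Matrix.single_apply_of_ne _ _ _ _ _ fun ⟨h1, h2⟩ => h (h1.symm.trans h2)
    rw [← Finset.sum_mul, ← Finset.mul_sum, h1, mul_one, zpowM_add]
  cases k with
  | ofNat n =>
    simp only [entryGrad]
    rw [Finset.sum_comm]
    simp [h, Nat.cast_smul_eq_nsmul]
  | negSucc m =>
    simp only [entryGrad, Finset.sum_neg_distrib]
    rw [Finset.sum_comm]
    simp only [h]
    have : ∀ i : ℕ, (-(i : ℤ) + -(m + 1 - i)) = Int.negSucc m := by
      intro i; rw [Int.negSucc_eq]; ring
    simp only [this, Finset.sum_const, Finset.card_range, Int.cast_negSucc]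
    rw [neg_smul, Nat.cast_smul_eq_nsmul]

/-- The directional derivatives of a polynomial in the power sums produce `loopDer`. -/
theorem exists_hasGrad_evalTrace (f : MvPolynomial ℤ ℂ) :
    ∃ G : UN N → Matrix (Fin N) (Fin N) ℂ, HasGrad (fun A => evalTrace A f) G ∧ Continuous G ∧
      ∀ k A, (zpowM A k * G A).trace = evalTrace A (loopDer k f) := by
  induction f using MvPolynomial.induction_on with
  | C a =>
    refine ⟨0, ?_, continuous_const, fun k A => ?_⟩
    · simpa [evalTrace] using HasGrad.const a
    · rw [← MvPolynomial.algebraMap_eq, Derivation.map_algebraMap]; simp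
  | add p q hp hq =>
    obtain ⟨G, h1, h2, h3⟩ := hp
    obtain ⟨H, h4, h5, h6⟩ := hq
    refine ⟨fun A => G A + H A, ?_, h2.add h5, fun k A => ?_⟩
    · simpa only [map_add] using h1.add h4
    · rw [mul_add, Matrix.trace_add, h3, h6, map_add, map_add]
  | mul_X p n hp =>
    obtain ⟨G, h1, h2, h3⟩ := hp
    have h4 : HasGrad (fun A : UN N => tracePow A n) (fun A => (n : ℂ) • zpowM A n) := by
      simp only [← sum_trace_entryGrad]
      exact HasGrad.sum Finset.univ fun a _ => hasGrad_zpowM n a a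
    have h5 : Continuous fun A : UN N => (n : ℂ) • zpowM A n :=
      (continuous_zpowM n).const_smul (n : ℂ)
    refine ⟨fun A => tracePow A n • G A + evalTrace A p • ((n : ℂ) • zpowM A n), ?_, ?_,
      fun k A => ?_⟩
    · simpa only [map_mul, evalTrace_X] using h1.mul h4
    · exact ((continuous_tracePow n).smul h2).add
        ((continuous_evalTrace p).smul h5)
    · rw [mul_add, Matrix.mul_smul, Matrix.mul_smul, Matrix.mul_smul, ← zpowM_add,
        Matrix.trace_add, Matrix.trace_smul, Matrix.trace_smul, Matrix.trace_smul, h3,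
        Derivation.leibniz, map_add]
      simp only [smul_eq_mul, map_mul, evalTrace_X, loopDer, MvPolynomial.mkDerivation_X,
        map_smul]
      simp only [tracePow]
      ring

/-- The loop equations for Haar measure: the sum over `a, b` of the derivatives of
`(A ^ k) a b * g A` in the directions of the matrix units has mean zero. -/
theorem integral_loop (k : ℤ) (g : MvPolynomial ℤ ℂ) :
    ∫ A, evalTrace A (loopPoly k * g + loopDer k g) ∂(haarUN N) = 0 := by
  obtain ⟨G, h1, h2, h3⟩ := exists_hasGrad_evalTrace (N := N) g
  have h4 : ∀ A : UN N, evalTrace A (loopPoly k * g + loopDer k g) =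
      ∑ a, ∑ b, (evalTrace A g • entryGrad k a b A + zpowM A k a b • G A) b a := by
    intro A
    rw [map_add, map_mul, ← h3, ← sum_entryGrad]
    simp only [Matrix.add_apply, Matrix.smul_apply, Finset.sum_add_distrib, smul_eq_mul,
      ← Finset.mul_sum]
    rw [mul_comm]
    rfl
  have h5 : ∀ a b, HasGrad (fun A : UN N => zpowM A k a b * evalTrace A g)
      (fun A => evalTrace A g • entryGrad k a b A + zpowM A k a b • G A) := fun a b =>
    (hasGrad_zpowM k a b).mul h1
  have hz : ∀ a b, Continuous fun A : UN N => zpowM A k a b := fun a b =>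
    (continuous_zpowM k).matrix_elem a b
  have h6 : ∀ a b, Continuous fun A : UN N =>
      evalTrace A g • entryGrad k a b A + zpowM A k a b • G A := fun a b =>
    ((continuous_evalTrace g).smul (continuous_entryGrad k a b)).add ((hz a b).smul h2)
  simp_rw [h4]
  have h7 : ∀ a b, Integrable (fun A : UN N =>
      (evalTrace A g • entryGrad k a b A + zpowM A k a b • G A) b a) (haarUN N) := fun a b =>
    integrable_of_continuous ((h6 a b).matrix_elem b a)
  rw [integral_finsetSum _ fun a _ => integrable_finsetSum _ fun b _ => h7 a b]
  refine Finset.sum_eq_zero fun a _ => ?_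
  rw [integral_finsetSum _ fun b _ => h7 a b]
  exact Finset.sum_eq_zero fun b _ =>
    (h5 a b).integral_eq_zero ((hz a b).mul (continuous_evalTrace g)) (h6 a b) b a

/-! ### Eigenvalues -/

/-- Both sides are multiplicative in `q`, and for linear `q` the claim is a value of the
characteristic polynomial. -/
theorem det_aeval_eq_prod {K : Type*} [Field K] [IsAlgClosed K] (M : Matrix (Fin N) (Fin N) K)
    (q : Polynomial K) :
    (Polynomial.aeval M q).det = (M.charpoly.roots.map fun w => q.eval w).prod := by
  have hsplit : M.charpoly.Splits := IsAlgClosed.splits _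
  have hcard : M.charpoly.roots.card = N := by
    rw [← hsplit.natDegree_eq_card_roots, Matrix.charpoly_natDegree_eq_dim, Fintype.card_fin]
  have hlin : ∀ a : K, (Polynomial.aeval M (Polynomial.X - Polynomial.C a)).det =
      (M.charpoly.roots.map fun w => (Polynomial.X - Polynomial.C a).eval w).prod := by
    intro a
    have h1 : Polynomial.aeval M (Polynomial.X - Polynomial.C a) =
        -(Matrix.scalar (Fin N) a - M) := by
      rw [map_sub, Polynomial.aeval_X, Polynomial.aeval_C, neg_sub]
      rfl
    have h2 : M.charpoly.eval a = (M.charpoly.roots.map fun w => a - w).prod := by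
      conv_lhs => rw [hsplit.eq_prod_roots_of_monic (Matrix.charpoly_monic M)]
      rw [Polynomial.eval_multiset_prod, Multiset.map_map]
      simp
    rw [h1, Matrix.det_neg, ← Matrix.eval_charpoly, h2, Fintype.card_fin]
    have h3 : (-1 : K) ^ N = (M.charpoly.roots.map fun _ => (-1 : K)).prod := by
      rw [Multiset.map_const', Multiset.prod_replicate, hcard]
    rw [h3, ← Multiset.prod_map_mul]
    simp
  have hprod : ∀ s : Multiset K,
      (Polynomial.aeval M (s.map fun a => Polynomial.X - Polynomial.C a).prod).det =
      (M.charpoly.roots.map fun w =>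
        (s.map fun a => Polynomial.X - Polynomial.C a).prod.eval w).prod := by
    intro s
    induction s using Multiset.induction with
    | empty => simp
    | cons a s ih =>
      simp only [Multiset.map_cons, Multiset.prod_cons, Polynomial.aeval_mul, Matrix.det_mul, hlin,
        ih, Polynomial.eval_mul, Multiset.prod_map_mul]
  rw [(IsAlgClosed.splits q).eq_prod_roots, Polynomial.aeval_mul, Matrix.det_mul, hprod]
  simp only [Polynomial.eval_mul, Multiset.prod_map_mul, Polynomial.eval_C, Multiset.map_const',
    Multiset.prod_replicate, hcard, Polynomial.aeval_C]
  congr 1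
  rw [Matrix.algebraMap_eq_diagonal, Matrix.det_diagonal]
  simp

theorem trace_pow_eq_sum_roots {K : Type*} [Field K] [IsAlgClosed K]
    (M : Matrix (Fin N) (Fin N) K) (n : ℕ) :
    (M ^ n).trace = (M.charpoly.roots.map fun w => w ^ n).sum := by
  have h : (M ^ n).charpoly =
      ((M.charpoly.roots.map fun w => w ^ n).map fun a => Polynomial.X - Polynomial.C a).prod := by
    refine Polynomial.funext fun c => ?_
    rw [Matrix.eval_charpoly, Polynomial.eval_multiset_prod, Multiset.map_map, Multiset.map_map]
    have h1 := det_aeval_eq_prod M (Polynomial.C c - Polynomial.X ^ n)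
    rw [map_sub, map_pow, Polynomial.aeval_X, Polynomial.aeval_C] at h1
    refine h1.trans ?_
    simp
  rw [Matrix.trace_eq_sum_roots_charpoly, h, Polynomial.roots_multiset_prod_X_sub_C]

/-- A point `x` of the circle `ℝ / ℤ`, as the complex number `e ^ (2πix)`. -/
noncomputable def circ (x : UnitAddCircle) : ℂ := (AddCircle.toCircle x : ℂ)

theorem norm_circ (x : UnitAddCircle) : ‖circ x‖ = 1 := Circle.norm_coe _

theorem circ_ne_zero (x : UnitAddCircle) : circ x ≠ 0 := Circle.coe_ne_zero _

theorem circ_zpow (x : UnitAddCircle) (k : ℤ) : circ x ^ k = fourier k x := by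
  rw [fourier_apply, AddCircle.toCircle_zsmul, Circle.coe_zpow, circ]

theorem continuous_circ : Continuous circ :=
  continuous_subtype_val.comp AddCircle.continuous_toCircle

theorem exists_circ_eq {w : ℂ} (hw : ‖w‖ = 1) : ∃ x, circ x = w := by
  obtain ⟨x, hx⟩ := (AddCircle.homeomorphCircle (T := 1) one_ne_zero).surjective
    ⟨w, mem_sphere_zero_iff_norm.2 hw⟩
  refine ⟨x, ?_⟩
  rw [AddCircle.homeomorphCircle_apply] at hx
  rw [circ, hx]

/-- The eigenvalues of a unitary matrix, in some order, as points of the torus. -/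
theorem exists_torus_roots (A : UN N) : ∃ x : Fin N → UnitAddCircle,
    (A : Matrix (Fin N) (Fin N) ℂ).charpoly.roots =
      (Finset.univ : Finset (Fin N)).val.map fun r => circ (x r) := by
  set M : Matrix (Fin N) (Fin N) ℂ := A.1 with hM
  have hw : ∀ w ∈ M.charpoly.roots, ‖w‖ = 1 := fun w hw => norm_eigenvalue_eq_one A.2
    (Matrix.mem_spectrum_of_isRoot_charpoly (Polynomial.isRoot_of_mem_roots hw))
  have hcard : M.charpoly.roots.card = N := by
    rw [← (IsAlgClosed.splits M.charpoly).natDegree_eq_card_roots,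
      Matrix.charpoly_natDegree_eq_dim, Fintype.card_fin]
  set l := M.charpoly.roots.toList with hl
  have hlen : l.length = N := by rw [hl, Multiset.length_toList, hcard]
  have hmem : ∀ r : Fin N, ∃ x, circ x = l.get (r.cast hlen.symm) := fun r =>
    exists_circ_eq (hw _ (Multiset.mem_toList.1 (List.get_mem _ _)))
  choose x hx using hmem
  refine ⟨x, ?_⟩
  rw [Fin.univ_val_map]
  have : List.ofFn (fun r => circ (x r)) = l := by
    simp only [hx]
    refine List.ext_get (by simp [hlen]) fun n h1 h2 => ?_
    simp
  rw [this, hl, Multiset.coe_toList]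

/-- The power sum `∑ r, z_r ^ k` of a point of the torus. -/
noncomputable def torusPow (x : Fin N → UnitAddCircle) (k : ℤ) : ℂ := ∑ r, circ (x r) ^ k

theorem conj_circ_zpow (x : UnitAddCircle) (k : ℤ) :
    (starRingEnd ℂ) (circ x ^ k) = circ x ^ (-k) := by
  rw [circ_zpow, circ_zpow, fourier_neg]

theorem tracePow_eq_torusPow {A : UN N} {x : Fin N → UnitAddCircle}
    (h : (A : Matrix (Fin N) (Fin N) ℂ).charpoly.roots =
      (Finset.univ : Finset (Fin N)).val.map fun r => circ (x r)) :
    tracePow A = torusPow x := by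
  have hnat : ∀ n : ℕ, tracePow A n = torusPow x n := by
    intro n
    have : zpowM A n = (A : Matrix (Fin N) (Fin N) ℂ) ^ n := by
      rw [zpowM, zpow_natCast]; rfl
    rw [tracePow, this, trace_pow_eq_sum_roots, h, Multiset.map_map, torusPow, Finset.sum]
    simp
  ext k
  obtain ⟨n, rfl | rfl⟩ := k.eq_nat_or_neg
  · exact hnat n
  · rw [tracePow, zpowM_neg, Matrix.trace_conjTranspose]
    change star (tracePow A n) = _
    rw [hnat, torusPow, torusPow, star_sum]
    exact Finset.sum_congr rfl fun r _ => conj_circ_zpow _ _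

/-! ### Laurent polynomials on the torus -/

/-- Haar probability measure on the torus. -/
noncomputable def torusHaar (N : ℕ) : Measure (Fin N → UnitAddCircle) :=
  Measure.pi fun _ => AddCircle.haarAddCircle

instance : IsProbabilityMeasure (torusHaar N) := by unfold torusHaar; infer_instance

/-- The value of a Laurent polynomial at a point of the torus. -/
noncomputable def torusEval (x : Fin N → UnitAddCircle) : Laurent N →ₐ[ℂ] ℂ :=
  AddMonoidAlgebra.lift ℂ ℂ (Fin N → ℤ)
    { toFun := fun μ => ∏ r, circ (x r) ^ (Multiplicative.toAdd μ r)
      map_one' := by simp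
      map_mul' := fun μ ν => by
        simp [zpow_add₀ (circ_ne_zero _), Finset.prod_mul_distrib] }

theorem torusEval_single (x : Fin N → UnitAddCircle) (μ : Fin N → ℤ) (a : ℂ) :
    torusEval x (.single μ a) = a * ∏ r, circ (x r) ^ μ r := by
  simp [torusEval, AddMonoidAlgebra.lift_single]

theorem torusEval_x (x : Fin N → UnitAddCircle) (r : Fin N) (k : ℤ) :
    torusEval x (Laurent.x r k) = circ (x r) ^ k := by
  rw [Laurent.x, torusEval_single, one_mul, Finset.prod_eq_single r]
  · simp
  · intro s _ hs; simp [hs]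
  · simp

theorem torusEval_psum (x : Fin N → UnitAddCircle) (k : ℤ) :
    torusEval x (Laurent.psum N k) = torusPow x k := by
  simp [Laurent.psum, torusPow, torusEval_x]

theorem torusEval_evalPsum (x : Fin N → UnitAddCircle) (f : MvPolynomial ℤ ℂ) :
    torusEval x (Laurent.evalPsum N f) = MvPolynomial.aeval (torusPow x) f := by
  have : (torusEval x).comp (Laurent.evalPsum N) = MvPolynomial.aeval (torusPow x) := by
    ext k; simp [Laurent.evalPsum_X, torusEval_psum]
  exact DFunLike.congr_fun this f

/-- The Vandermonde product `∏ i < j, (z_j - z_i)` at a point of the torus. -/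
noncomputable def torusVand (x : Fin N → UnitAddCircle) : ℂ :=
  (Matrix.vandermonde fun r => circ (x r)).det

theorem torusEval_vand (x : Fin N → UnitAddCircle) :
    torusEval x (Laurent.vand N) = torusVand x := by
  rw [Laurent.vand, AlgHom.map_det, torusVand]
  congr 1
  ext i j
  simp [Matrix.vandermonde_apply, torusEval_x]

theorem continuous_torusEval (F : Laurent N) :
    Continuous fun x : Fin N → UnitAddCircle => torusEval x F := by
  induction F using AddMonoidAlgebra.induction_linear with
  | zero => simpa using continuous_const
  | add F G hF hG => simp only [map_add]; exact hF.add hG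
  | single μ a =>
    simp only [torusEval_single, circ_zpow]
    exact continuous_const.mul (continuous_finsetProd _ fun r _ =>
      (fourier (μ r)).continuous.comp (continuous_apply r))

theorem integrable_torus {f : (Fin N → UnitAddCircle) → ℂ} (hf : Continuous f) :
    Integrable f (torusHaar N) :=
  hf.integrable_of_hasCompactSupport (HasCompactSupport.of_compactSpace _)

theorem integral_fourier (n : ℤ) :
    ∫ x : UnitAddCircle, fourier n x ∂AddCircle.haarAddCircle = if n = 0 then 1 else 0 := by
  have h := orthonormal_iff_ite.1 (orthonormal_fourier (T := (1 : ℝ))) 0 n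
  rw [ContinuousMap.inner_toLp] at h
  simpa [eq_comm] using h

/-- Integration over the torus picks the constant term. -/
theorem integral_torusEval (F : Laurent N) :
    ∫ x, torusEval x F ∂(torusHaar N) = F.coeff 0 := by
  induction F using AddMonoidAlgebra.induction_linear with
  | zero => simp
  | add F G hF hG =>
    simp only [map_add]
    rw [integral_add (integrable_torus (continuous_torusEval F))
      (integrable_torus (continuous_torusEval G)), hF, hG]
    rfl
  | single μ a =>
    simp only [torusEval_single, circ_zpow]
    rw [integral_const_mul, torusHaar,
      integral_fintype_prod_eq_prod (𝕜 := ℂ) (fun r (y : UnitAddCircle) => fourier (μ r) y)]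
    simp only [integral_fourier, AddMonoidAlgebra.coeff_single]
    by_cases h : μ = 0
    · simp [h]
    · obtain ⟨r, hr⟩ := Function.ne_iff.1 h
      rw [Finset.prod_eq_zero (Finset.mem_univ r) (if_neg hr), Finsupp.single_apply, if_neg h,
        mul_zero]

/-- The constant-term definition of the Weyl functional is an integral against the Weyl density. -/
theorem weyl_eq_integral (f : MvPolynomial ℤ ℂ) :
    Laurent.weyl N f = ∫ x, ((‖torusVand x‖ ^ 2 / N.factorial : ℝ) : ℂ) *
      MvPolynomial.aeval (torusPow x) f ∂(torusHaar N) := by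
  classical
  have h1 : ∀ x : Fin N → UnitAddCircle, ((‖torusVand x‖ ^ 2 / N.factorial : ℝ) : ℂ) *
      MvPolynomial.aeval (torusPow x) f = (N.factorial : ℂ)⁻¹ *
      ∑ σ : Equiv.Perm (Fin N), ((Equiv.Perm.sign σ : ℤ) : ℂ) *
        torusEval x (.single (-Laurent.permExp σ) 1 *
          (Laurent.vand N * Laurent.evalPsum N f)) := by
    intro x
    have h2 : (starRingEnd ℂ) (torusVand x) =
        ∑ σ : Equiv.Perm (Fin N), ((Equiv.Perm.sign σ : ℤ) : ℂ) *
          torusEval x (.single (-Laurent.permExp σ) 1) := by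
      rw [← torusEval_vand, Laurent.vand_eq_sum, map_sum, map_sum]
      refine Finset.sum_congr rfl fun σ _ => ?_
      rw [torusEval_single, torusEval_single, map_mul, map_prod, one_mul]
      simp only [conj_circ_zpow, map_intCast, Pi.neg_apply]
    have h3 : ((‖torusVand x‖ ^ 2 : ℝ) : ℂ) = (starRingEnd ℂ) (torusVand x) * torusVand x := by
      rw [Complex.conj_mul']; push_cast; rfl
    rw [Complex.ofReal_div, h3, h2]
    simp only [map_mul, torusEval_vand, torusEval_evalPsum, ← mul_assoc, ← Finset.sum_mul]
    push_cast
    ring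
  simp_rw [h1]
  rw [integral_const_mul, integral_finsetSum _ fun σ _ =>
    (integrable_torus (continuous_torusEval _)).const_mul _]
  rw [Laurent.weyl]
  congr 1
  refine Finset.sum_congr rfl fun σ _ => ?_
  rw [integral_const_mul, integral_torusEval]
  congr 1
  rw [AddMonoidAlgebra.coeff_single_mul_apply]
  simp

/-- Weyl's integration formula for polynomials in the power sums. -/
theorem integral_evalTrace (f : MvPolynomial ℤ ℂ) :
    ∫ A, evalTrace A f ∂(haarUN N) = ∫ x, ((‖torusVand x‖ ^ 2 / N.factorial : ℝ) : ℂ) *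
      MvPolynomial.aeval (torusPow x) f ∂(torusHaar N) := by
  rw [← weyl_eq_integral]
  let ℓ : MvPolynomial ℤ ℂ →ₗ[ℂ] ℂ :=
    { toFun := fun f => ∫ A, evalTrace A f ∂(haarUN N)
      map_add' := fun f g => by
        simp only [map_add]
        exact integral_add (integrable_of_continuous (continuous_evalTrace f))
          (integrable_of_continuous (continuous_evalTrace g))
      map_smul' := fun c f => by
        simp only [map_smul, smul_eq_mul, integral_const_mul, RingHom.id_apply] }
  refine Laurent.eq_weyl_of_loop ℓ (fun k g => integral_loop k g) (fun g c hg => ?_) f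
  have : ∀ A : UN N, evalTrace A g = c := by
    intro A
    obtain ⟨x, hx⟩ := exists_torus_roots A
    rw [evalTrace, tracePow_eq_torusPow hx, ← torusEval_evalPsum, hg, AlgHom.commutes]
    rfl
  change ∫ A, evalTrace A g ∂(haarUN N) = c
  simp [this]

/-! ### Weyl's integration formula -/

/-- The points of the torus modulo permutation, realised by their power sums. -/
def powSet (N : ℕ) : Set (ℤ → ℂ) := Set.range (torusPow (N := N))

/-- The power sums of a point of the torus, as a point of `powSet`. -/
noncomputable def torusClass (x : Fin N → UnitAddCircle) : powSet N := ⟨torusPow x, x, rfl⟩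

/-- The power sums of a unitary matrix, as a point of `powSet`. -/
noncomputable def unitaryClass (A : UN N) : powSet N :=
  ⟨tracePow A, by
    obtain ⟨x, hx⟩ := exists_torus_roots A
    exact ⟨x, (tracePow_eq_torusPow hx).symm⟩⟩

theorem continuous_torusPow : Continuous (torusPow (N := N)) := by
  refine continuous_pi fun k => ?_
  simp only [torusPow, circ_zpow]
  exact continuous_finsetSum _ fun r _ => (fourier k).continuous.comp (continuous_apply r)

theorem continuous_torusClass : Continuous (torusClass (N := N)) :=
  continuous_torusPow.subtype_mk _

theorem surjective_torusClass : Function.Surjective (torusClass (N := N)) := by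
  rintro ⟨_, x, rfl⟩
  exact ⟨x, rfl⟩

theorem continuous_unitaryClass : Continuous (unitaryClass (N := N)) :=
  (continuous_pi fun k => continuous_tracePow k).subtype_mk _

theorem isCompact_powSet : IsCompact (powSet N) := isCompact_range continuous_torusPow

instance : CompactSpace (powSet N) := isCompact_iff_compactSpace.1 isCompact_powSet

instance : PolishSpace (powSet N) := isCompact_powSet.isClosed.polishSpace

/-- The Weyl measure `|vand| ^ 2 / N!` on the torus. -/
noncomputable def weylMeasure (N : ℕ) : Measure (Fin N → UnitAddCircle) :=
  (torusHaar N).withDensity fun x => ENNReal.ofReal (‖torusVand x‖ ^ 2 / N.factorial)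

theorem continuous_torusVand : Continuous (torusVand (N := N)) := by
  have := continuous_torusEval (Laurent.vand N)
  simpa only [torusEval_vand] using this

theorem measurable_weylDensity : Measurable fun x : Fin N → UnitAddCircle =>
    ENNReal.ofReal (‖torusVand x‖ ^ 2 / N.factorial) :=
  ((continuous_torusVand.norm.pow 2).div_const _).measurable.ennreal_ofReal

theorem integral_weylMeasure (g : (Fin N → UnitAddCircle) → ℂ) : ∫ x, g x ∂(weylMeasure N) =
    ∫ x, ((‖torusVand x‖ ^ 2 / N.factorial : ℝ) : ℂ) * g x ∂(torusHaar N) := by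
  rw [weylMeasure, integral_withDensity_eq_integral_toReal_smul measurable_weylDensity
    (Eventually.of_forall fun _ => ENNReal.ofReal_lt_top)]
  refine integral_congr_ae (Eventually.of_forall fun x => ?_)
  simp only
  rw [ENNReal.toReal_ofReal (by positivity), Complex.real_smul]

theorem integrable_weylMeasure_iff (g : (Fin N → UnitAddCircle) → ℂ) :
    Integrable g (weylMeasure N) ↔
      Integrable (fun x => ((‖torusVand x‖ ^ 2 / N.factorial : ℝ) : ℂ) * g x) (torusHaar N) := by
  rw [weylMeasure, integrable_withDensity_iff_integrable_smul' measurable_weylDensity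
    (Eventually.of_forall fun _ => ENNReal.ofReal_lt_top)]
  refine integrable_congr (Eventually.of_forall fun x => ?_)
  simp only
  rw [ENNReal.toReal_ofReal (by positivity), Complex.real_smul]

instance : IsFiniteMeasure (weylMeasure N) := by
  refine ⟨?_⟩
  have hc : Continuous fun x : Fin N → UnitAddCircle => ‖torusVand x‖ ^ 2 / (N.factorial : ℝ) :=
    (continuous_torusVand.norm.pow 2).div_const _
  obtain ⟨C, hC⟩ := (isCompact_univ (X := Fin N → UnitAddCircle)).exists_bound_of_continuousOn
    hc.continuousOn
  rw [weylMeasure, withDensity_apply _ MeasurableSet.univ, Measure.restrict_univ]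
  refine (lintegral_mono fun x => ENNReal.ofReal_le_ofReal
    ((le_abs_self _).trans (hC x (Set.mem_univ _)))).trans_lt ?_
  simp

theorem exists_conj_aeval (f : MvPolynomial ℤ ℂ) : ∃ g : MvPolynomial ℤ ℂ,
    ∀ x : Fin N → UnitAddCircle,
      star (MvPolynomial.aeval (torusPow x) f) = MvPolynomial.aeval (torusPow x) g := by
  induction f using MvPolynomial.induction_on with
  | C a => exact ⟨.C (star a), fun x => by simp⟩
  | add p q hp hq =>
    obtain ⟨p', hp⟩ := hp
    obtain ⟨q', hq⟩ := hq
    exact ⟨p' + q', fun x => by rw [map_add, star_add, hp, hq, map_add]⟩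
  | mul_X p n hp =>
    obtain ⟨p', hp⟩ := hp
    refine ⟨p' * .X (-n), fun x => ?_⟩
    rw [map_mul, star_mul', hp, map_mul, MvPolynomial.aeval_X, MvPolynomial.aeval_X, torusPow,
      torusPow, star_sum]
    congr 1
    exact Finset.sum_congr rfl fun r _ => conj_circ_zpow _ _

/-- The polynomials in the power sums, as continuous functions on `powSet`. -/
noncomputable def powAlgebra (N : ℕ) :
    StarSubalgebra ℂ (BoundedContinuousFunction (powSet N) ℂ) where
  carrier := {g | ∃ f : MvPolynomial ℤ ℂ, ∀ s : powSet N, g s = MvPolynomial.aeval s.1 f}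
  mul_mem' := by
    rintro a b ⟨f, hf⟩ ⟨g, hg⟩
    exact ⟨f * g, fun s => by simp [hf, hg]⟩
  add_mem' := by
    rintro a b ⟨f, hf⟩ ⟨g, hg⟩
    exact ⟨f + g, fun s => by simp [hf, hg]⟩
  algebraMap_mem' := fun c => ⟨.C c, fun s => by simp⟩
  star_mem' := by
    rintro a ⟨f, hf⟩
    obtain ⟨g, hg⟩ := exists_conj_aeval (N := N) f
    refine ⟨g, ?_⟩
    rintro ⟨_, x, rfl⟩
    rw [BoundedContinuousFunction.star_apply, hf]
    exact hg x

/-- Weyl's integration formula, as an equality of measures: polynomials in the power sums have the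
same integrals by `integral_evalTrace`, and they separate the points of `powSet`. -/
theorem map_unitaryClass_haar :
    (haarUN N).map unitaryClass = (weylMeasure N).map torusClass := by
  have hU := (continuous_unitaryClass (N := N)).measurable
  have hT := (continuous_torusClass (N := N)).measurable
  refine ext_of_forall_mem_subalgebra_integral_eq_of_polish (𝕜 := ℂ) (A := powAlgebra N) ?_ ?_
  · intro s t hst
    obtain ⟨k, hk⟩ := Function.ne_iff.1 (Subtype.coe_injective.ne hst)
    let g : C(powSet N, ℂ) := ⟨fun s => s.1 k, (continuous_apply k).comp continuous_subtype_val⟩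
    refine ⟨g, ⟨g, ?_, rfl⟩, hk⟩
    exact ⟨BoundedContinuousFunction.mkOfCompact g, ⟨.X k, fun s => by simp [g]⟩, rfl⟩
  · rintro g ⟨f, hf⟩
    rw [integral_map hU.aemeasurable g.continuous.aestronglyMeasurable,
      integral_map hT.aemeasurable g.continuous.aestronglyMeasurable, integral_weylMeasure]
    simp only [hf]
    exact integral_evalTrace f

/-- Power sums determine a finite multiset of complex numbers: by linearity the sums of the values
of any polynomial agree, and suitable ones isolate a multiplicity. -/
theorem multiset_eq_of_sum_pow_eq (s t : Multiset ℂ)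
    (h : ∀ n : ℕ, (s.map fun w => w ^ n).sum = (t.map fun w => w ^ n).sum) : s = t := by
  classical
  have hpoly : ∀ p : Polynomial ℂ,
      (s.map fun w => p.eval w).sum = (t.map fun w => p.eval w).sum := by
    intro p
    induction p using Polynomial.induction_on' with
    | add p q hp hq => simp only [Polynomial.eval_add, Multiset.sum_map_add, hp, hq]
    | monomial n a => simp only [Polynomial.eval_monomial, Multiset.sum_map_mul_left, h]
  ext a
  -- a polynomial that vanishes at all the points involved except `a`
  set p : Polynomial ℂ := ∏ b ∈ ((s + t).toFinset.erase a), (Polynomial.X - Polynomial.C b) with hp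
  have hpa : p.eval a ≠ 0 := by
    rw [hp, Polynomial.eval_prod]
    refine Finset.prod_ne_zero_iff.2 fun b hb => ?_
    rw [Polynomial.eval_sub, Polynomial.eval_X, Polynomial.eval_C]
    exact sub_ne_zero.2 (Finset.ne_of_mem_erase hb).symm
  have hcount : ∀ u : Multiset ℂ, (∀ b ∈ u, b ∈ s + t) →
      (u.map fun w => p.eval w).sum = u.count a * p.eval a := by
    intro u hu
    induction u using Multiset.induction with
    | empty => simp
    | cons b u ih =>
      rw [Multiset.map_cons, Multiset.sum_cons,
        ih fun c hc => hu c (Multiset.mem_cons_of_mem hc)]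
      rcases eq_or_ne a b with rfl | hab
      · rw [Multiset.count_cons_self]; push_cast; ring
      · rw [Multiset.count_cons_of_ne hab]
        have : p.eval b = 0 := by
          rw [hp, Polynomial.eval_prod]
          refine Finset.prod_eq_zero (i := b) ?_ (by simp)
          exact Finset.mem_erase.2 ⟨hab.symm,
            Multiset.mem_toFinset.2 (hu b (Multiset.mem_cons_self _ _))⟩
        rw [this, zero_add]
  have h1 := hpoly p
  rw [hcount s fun b hb => Multiset.mem_add.2 (Or.inl hb),
    hcount t fun b hb => Multiset.mem_add.2 (Or.inr hb)] at h1
  exact_mod_cast mul_right_cancel₀ hpa h1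

theorem torusPow_eq_iff (x y : Fin N → UnitAddCircle) : torusPow x = torusPow y ↔
    (Finset.univ : Finset (Fin N)).val.map (fun r => circ (x r)) =
      (Finset.univ : Finset (Fin N)).val.map (fun r => circ (y r)) := by
  constructor
  · intro h
    refine multiset_eq_of_sum_pow_eq _ _ fun n => ?_
    have := congrFun h n
    simpa [torusPow, Finset.sum, Function.comp_def] using this
  · intro h
    ext k
    have := congrArg (fun s : Multiset ℂ => (s.map fun w => w ^ k).sum) h
    simpa [torusPow, Finset.sum, Function.comp_def] using this

/-- The diagonal matrix with the eigenvalues of a point of the torus. -/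
noncomputable def torusDiag (x : Fin N → UnitAddCircle) : UN N :=
  ⟨Matrix.diagonal fun r => circ (x r), by
    rw [Matrix.mem_unitaryGroup_iff, Matrix.star_eq_conjTranspose, Matrix.diagonal_conjTranspose,
      Matrix.diagonal_mul_diagonal, ← Matrix.diagonal_one]
    congr 1
    ext r
    have := Complex.mul_conj' (circ (x r))
    rw [norm_circ] at this
    simpa using this⟩

theorem roots_charpoly_torusDiag (x : Fin N → UnitAddCircle) :
    (torusDiag x : Matrix (Fin N) (Fin N) ℂ).charpoly.roots =
      (Finset.univ : Finset (Fin N)).val.map fun r => circ (x r) := by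
  rw [torusDiag, Matrix.charpoly_diagonal]
  have := Polynomial.roots_multiset_prod_X_sub_C
    ((Finset.univ : Finset (Fin N)).val.map fun r => circ (x r))
  rwa [Multiset.map_map] at this

/-- Weyl's integration formula for a class function `G` on `U(N)` that is given by the function `g`
of the eigenvalues. -/
theorem weyl_integration {G : UN N → ℂ} {g : (Fin N → UnitAddCircle) → ℂ} (hg : Measurable g)
    (h : ∀ (A : UN N) (x : Fin N → UnitAddCircle), (A : Matrix (Fin N) (Fin N) ℂ).charpoly.roots =
      (Finset.univ : Finset (Fin N)).val.map (fun r => circ (x r)) → G A = g x) :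
    (Integrable G (haarUN N) ↔ Integrable (fun x => ((‖torusVand x‖ ^ 2 / N.factorial : ℝ) : ℂ) *
      g x) (torusHaar N)) ∧
    ∫ A, G A ∂(haarUN N) =
      ∫ x, ((‖torusVand x‖ ^ 2 / N.factorial : ℝ) : ℂ) * g x ∂(torusHaar N) := by
  have hU := (continuous_unitaryClass (N := N)).measurable
  have hT := (continuous_torusClass (N := N)).measurable
  set e : powSet N → ℂ := fun s => g (surjective_torusClass s).choose with he
  have heT : e ∘ torusClass = g := by
    ext x
    have h1 := (surjective_torusClass (torusClass x)).choose_spec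
    set y := (surjective_torusClass (torusClass x)).choose
    have h2 := (torusPow_eq_iff y x).1 (congrArg Subtype.val h1)
    rw [Function.comp_apply, ← h _ _ (roots_charpoly_torusDiag x)]
    exact (h _ _ ((roots_charpoly_torusDiag x).trans h2.symm)).symm
  have heU : e ∘ unitaryClass = G := by
    ext A
    obtain ⟨x, hx⟩ := exists_torus_roots A
    have h1 : unitaryClass A = torusClass x := Subtype.ext (tracePow_eq_torusPow hx)
    rw [Function.comp_apply, h1, h A x hx, ← heT, Function.comp_apply]
  have hem : Measurable e := (hT.measurable_comp_iff_of_surjective surjective_torusClass).1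
    (by rw [heT]; exact hg)
  constructor
  · rw [← integrable_weylMeasure_iff, ← heU, ← heT,
      ← integrable_map_measure hem.aestronglyMeasurable hU.aemeasurable,
      ← integrable_map_measure hem.aestronglyMeasurable hT.aemeasurable, map_unitaryClass_haar]
  · rw [← integral_weylMeasure, ← heU, ← heT]
    simp only [Function.comp_apply]
    rw [← integral_map hU.aemeasurable hem.aestronglyMeasurable,
      ← integral_map hT.aemeasurable hem.aestronglyMeasurable, map_unitaryClass_haar]

/-! ### The moment as an integral over the torus -/

/-- The `r`-th summand `Z'(θ_r) ^ k`, in terms of the eigenvalues. -/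
noncomputable def torusDerivPow (k : ℂ) (x : Fin N → UnitAddCircle) (r : Fin N) : ℂ :=
  ((∏ j ∈ Finset.univ.erase r, ‖1 - circ (x j) / circ (x r)‖ : ℝ) : ℂ) ^ k *
    Complex.exp (Complex.I * k *
      ((π / 2 + ∑ j ∈ Finset.univ.erase r, (1 - circ (x j) / circ (x r)).arg : ℝ) : ℂ))

theorem exp_I_mul_arg {w : ℂ} (hw : ‖w‖ = 1) : Complex.exp (Complex.I * (w.arg : ℂ)) = w := by
  have := Complex.norm_mul_exp_arg_mul_I w
  rw [hw] at this
  rw [mul_comm]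
  simpa using this

/-- The mean of `Z'(θ_n) ^ k` only depends on the eigenvalues, listed in any order. -/
theorem meanDerivPow_eq_torus (k : ℂ) {A : UN N} {x : Fin N → UnitAddCircle}
    (hx : (A : Matrix (Fin N) (Fin N) ℂ).charpoly.roots =
      (Finset.univ : Finset (Fin N)).val.map fun r => circ (x r)) :
    meanDerivPow k (A : Matrix (Fin N) (Fin N) ℂ) = (1 / (N : ℂ)) * ∑ r, torusDerivPow k x r := by
  have hang : eigenangles (A : Matrix (Fin N) (Fin N) ℂ) =
      (Finset.univ : Finset (Fin N)).val.map fun r => (circ (x r)).arg := by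
    rw [eigenangles, hx, Multiset.map_map]; rfl
  have herase : ∀ r : Fin N, (eigenangles (A : Matrix (Fin N) (Fin N) ℂ)).erase (circ (x r)).arg =
      (Finset.univ.erase r : Finset (Fin N)).val.map fun r => (circ (x r)).arg := by
    intro r
    rw [hang]
    have : (Finset.univ : Finset (Fin N)).val =
        r ::ₘ (Finset.univ.erase r : Finset (Fin N)).val := by
      rw [Finset.erase_val, Multiset.cons_erase (Finset.mem_univ_val r)]
    conv_lhs => rw [this, Multiset.map_cons, Multiset.erase_cons_head]
  have hquot : ∀ r j : Fin N, 1 - Complex.exp (Complex.I * (((circ (x j)).arg : ℂ) -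
      ((circ (x r)).arg : ℂ))) = 1 - circ (x j) / circ (x r) := by
    intro r j
    rw [mul_sub, Complex.exp_sub, exp_I_mul_arg (norm_circ _), exp_I_mul_arg (norm_circ _)]
  rw [meanDerivPow, hang, Multiset.map_map]
  congr 1
  refine Finset.sum_congr rfl fun r _ => ?_
  have hmem : (circ (x r)).arg ∈ eigenangles (A : Matrix (Fin N) (Fin N) ℂ) := by
    rw [hang]; exact Multiset.mem_map.2 ⟨r, Finset.mem_univ_val r, rfl⟩
  rw [Function.comp_apply, derivPow, deriv_charZ A.2 hmem, derivArg, herase, Multiset.map_map,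
    Multiset.map_map, norm_mul, Complex.norm_I, one_mul]
  simp only [Function.comp_def, hquot]
  have h1 : ((Finset.univ.erase r).val.map fun j => 1 - circ (x j) / circ (x r)).prod =
      ∏ j ∈ Finset.univ.erase r, (1 - circ (x j) / circ (x r)) := rfl
  have h2 : ((Finset.univ.erase r).val.map fun j => (1 - circ (x j) / circ (x r)).arg).sum =
      ∑ j ∈ Finset.univ.erase r, (1 - circ (x j) / circ (x r)).arg := rfl
  rw [h1, h2, norm_prod, torusDerivPow]

theorem measurable_torusDerivPow (k : ℂ) (r : Fin N) :
    Measurable fun x : Fin N → UnitAddCircle => torusDerivPow k x r := by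
  have hq : ∀ j : Fin N, Measurable fun x : Fin N → UnitAddCircle =>
      1 - circ (x j) / circ (x r) := fun j =>
    measurable_const.sub ((continuous_circ.measurable.comp (measurable_pi_apply j)).div
      (continuous_circ.measurable.comp (measurable_pi_apply r)))
  have h1 : Measurable fun x : Fin N → UnitAddCircle =>
      ((∏ j ∈ Finset.univ.erase r, ‖1 - circ (x j) / circ (x r)‖ : ℝ) : ℂ) :=
    Complex.measurable_ofReal.comp (Finset.measurable_fun_prod _ fun j _ => (hq j).norm)
  have h2 : Measurable fun x : Fin N → UnitAddCircle =>
      ((π / 2 + ∑ j ∈ Finset.univ.erase r, (1 - circ (x j) / circ (x r)).arg : ℝ) : ℂ) :=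
    Complex.measurable_ofReal.comp (measurable_const.add
      (Finset.measurable_fun_sum _ fun j _ => Complex.measurable_arg.comp (hq j)))
  exact (h1.pow_const k).mul (Complex.measurable_exp.comp (measurable_const.mul h2))

/-- The one-variable weight `|1 - z| ^ 2 (1 - z) ^ k`, with the principal power. -/
noncomputable def weight (k : ℂ) (y : UnitAddCircle) : ℂ :=
  ((‖1 - circ y‖ ^ 2 : ℝ) : ℂ) * (1 - circ y) ^ k

/-- For distinct eigenvalues, the choice of the argument makes `Z'(θ_r) ^ k` a product of principal
powers. -/
theorem torusDerivPow_eq (k : ℂ) (x : Fin N → UnitAddCircle) (r : Fin N)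
    (h : ∀ j, j ≠ r → 1 - circ (x j) / circ (x r) ≠ 0) :
    torusDerivPow k x r = Complex.exp (Complex.I * π * k / 2) *
      ∏ j ∈ Finset.univ.erase r, (1 - circ (x j) / circ (x r)) ^ k := by
  have h1 : ∀ s : Finset (Fin N), ((∏ j ∈ s, ‖1 - circ (x j) / circ (x r)‖ : ℝ) : ℂ) ^ k =
      ∏ j ∈ s, ((‖1 - circ (x j) / circ (x r)‖ : ℝ) : ℂ) ^ k := by
    intro s
    induction s using Finset.induction_on with
    | empty => simp
    | insert i s hi ih =>
      rw [Finset.prod_insert hi, Finset.prod_insert hi, Complex.ofReal_mul,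
        Complex.mul_cpow_ofReal_nonneg (norm_nonneg _)
          (Finset.prod_nonneg fun _ _ => norm_nonneg _), ih]
  have h2 : ∀ z : ℂ, z ≠ 0 → z ^ k = ((‖z‖ : ℝ) : ℂ) ^ k *
      Complex.exp (Complex.I * k * (z.arg : ℂ)) := by
    intro z hz
    rw [Complex.cpow_def_of_ne_zero hz,
      Complex.cpow_def_of_ne_zero (Complex.ofReal_ne_zero.2 (norm_ne_zero_iff.2 hz)),
      ← Complex.exp_add, Complex.log, ← Complex.ofReal_log (norm_nonneg z)]
    congr 1
    ring
  rw [torusDerivPow, h1, Finset.prod_congr rfl fun j hj =>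
    h2 _ (h j (Finset.ne_of_mem_erase hj)), Finset.prod_mul_distrib, ← Complex.exp_sum,
    mul_left_comm, ← Complex.exp_add]
  congr 2
  push_cast
  rw [mul_add, Finset.mul_sum]
  ring

theorem norm_torusVand_comp_perm (x : Fin N → UnitAddCircle) (σ : Equiv.Perm (Fin N)) :
    ‖torusVand (x ∘ σ)‖ = ‖torusVand x‖ := by
  have : torusVand (x ∘ σ) = ((Equiv.Perm.sign σ : ℤ) : ℂ) * torusVand x := by
    rw [torusVand, torusVand, ← Matrix.det_permute]
    rfl
  rw [this, norm_mul]
  rcases Int.units_eq_one_or (Equiv.Perm.sign σ) with h | h <;> simp [h]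

theorem torusVand_cons {n : ℕ} (a : UnitAddCircle) (y : Fin n → UnitAddCircle) :
    torusVand (Fin.cons a y : Fin (n + 1) → UnitAddCircle) =
      (∏ j, (circ (y j) - circ a)) * torusVand y := by
  rw [torusVand, torusVand, Matrix.det_vandermonde, Matrix.det_vandermonde, Fin.prod_univ_succ,
    Fin.prod_Ioi_zero]
  simp [Fin.prod_Ioi_succ]

/-- The eigenangles relative to the `r`-th one. -/
def relative {n : ℕ} (r : Fin (n + 1)) (x : Fin (n + 1) → UnitAddCircle) (j : Fin n) :
    UnitAddCircle := x (r.succAbove j) - x r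

theorem circ_add (a b : UnitAddCircle) : circ (a + b) = circ a * circ b := by
  rw [circ, AddCircle.toCircle_add, Circle.coe_mul]; rfl

theorem circ_sub (a b : UnitAddCircle) : circ (a - b) = circ a / circ b := by
  rw [eq_div_iff (circ_ne_zero b), ← circ_add, sub_add_cancel]

theorem norm_torusVand_add {n : ℕ} (a : UnitAddCircle) (y : Fin n → UnitAddCircle) :
    ‖torusVand fun j => a + y j‖ = ‖torusVand y‖ := by
  simp only [torusVand, Matrix.det_vandermonde, norm_prod, circ_add]
  refine Finset.prod_congr rfl fun i _ => Finset.prod_congr rfl fun j _ => ?_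
  rw [← mul_sub, norm_mul, norm_circ, one_mul]

theorem norm_torusVand_relative {n : ℕ} (r : Fin (n + 1)) (x : Fin (n + 1) → UnitAddCircle) :
    ‖torusVand x‖ = (∏ j, ‖1 - circ (relative r x j)‖) * ‖torusVand (relative r x)‖ := by
  rw [← norm_torusVand_comp_perm x r.cycleRange.symm,
    ← Fin.cons_removeNth_eq_comp_cycleRange_symm, torusVand_cons, norm_mul, norm_prod,
    ← norm_torusVand_add (x r) (relative r x)]
  congr 1
  · refine Finset.prod_congr rfl fun j _ => ?_
    have : circ (relative r x j) = circ (r.removeNth x j) / circ (x r) := circ_sub _ _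
    rw [this, one_sub_div (circ_ne_zero _), norm_div, norm_circ, div_one, norm_sub_rev]
  · congr 2
    ext j
    simp [relative, Fin.removeNth]

/-- The differences `x_j - x_r` are independent and uniform, by translation invariance. -/
theorem measurePreserving_relative {n : ℕ} (r : Fin (n + 1)) :
    MeasurePreserving (relative r) (torusHaar (n + 1)) (torusHaar n) := by
  have h1 := measurePreserving_piFinSuccAbove
    (fun _ : Fin (n + 1) => (AddCircle.haarAddCircle : Measure UnitAddCircle)) r
  have h2 : MeasurePreserving
      (fun p : UnitAddCircle × (Fin n → UnitAddCircle) => (p.1, fun j => p.2 j - p.1))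
      ((AddCircle.haarAddCircle : Measure UnitAddCircle).prod (torusHaar n))
      ((AddCircle.haarAddCircle : Measure UnitAddCircle).prod (torusHaar n)) := by
    refine (MeasurePreserving.id _).skew_product
      (g := fun (a : UnitAddCircle) (y : Fin n → UnitAddCircle) (j : Fin n) => y j - a) ?_
      (Eventually.of_forall fun a => ?_)
    · exact measurable_pi_iff.2 fun j =>
        ((measurable_pi_apply j).comp measurable_snd).sub measurable_fst
    · have : (torusHaar n).IsAddLeftInvariant := by unfold torusHaar; infer_instance
      have := map_add_left_eq_self (torusHaar n) (fun _ => -a)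
      convert this using 2
      ext y j
      simp [sub_eq_neg_add]
  exact (measurePreserving_snd.comp h2).comp h1

/-- The joint weight of the relative eigenangles: the Weyl density without its factor `1 / n!`,
times the product of the one-variable weights. -/
noncomputable def relWeight (k : ℂ) {n : ℕ} (w : Fin n → UnitAddCircle) : ℂ :=
  ((‖torusVand w‖ ^ 2 : ℝ) : ℂ) * ∏ j, weight k (w j)

theorem vand_mul_torusDerivPow (k : ℂ) {n : ℕ} (x : Fin (n + 1) → UnitAddCircle)
    (r : Fin (n + 1)) : ((‖torusVand x‖ ^ 2 : ℝ) : ℂ) * torusDerivPow k x r =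
      Complex.exp (Complex.I * π * k / 2) * relWeight k (relative r x) := by
  have hsucc : ∀ f : Fin (n + 1) → ℂ, ∏ j ∈ Finset.univ.erase r, f j =
      ∏ j, f (r.succAbove j) := by
    intro f
    rw [← Finset.compl_singleton, ← Fin.image_succAbove_univ,
      Finset.prod_image fun i _ j _ h => Fin.succAbove_right_injective h]
  -- at a repeated eigenvalue both sides vanish, whatever value the complex power takes there
  by_cases h : ∀ j, 1 - circ (relative r x j) ≠ 0
  · rw [torusDerivPow_eq, hsucc, norm_torusVand_relative r x, relWeight]
    · simp only [weight, relative, circ_sub, Finset.prod_mul_distrib]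
      push_cast
      rw [mul_pow, Finset.prod_pow]
      ring
    · intro j hj
      obtain ⟨i, rfl⟩ := Fin.exists_succAbove_eq hj
      have := h i
      rwa [relative, circ_sub] at this
  · push Not at h
    obtain ⟨j, hj⟩ := h
    have h1 : ‖torusVand x‖ = 0 := by
      rw [norm_torusVand_relative r, Finset.prod_eq_zero (Finset.mem_univ j) (by simp [hj]),
        zero_mul]
    have h2 : ∏ j, weight k (relative r x j) = 0 :=
      Finset.prod_eq_zero (Finset.mem_univ j) (by simp [weight, hj])
    simp [h1, relWeight, h2]

theorem integrable_mul_prod {n : ℕ} {f : (Fin n → UnitAddCircle) → ℂ} (hf : Continuous f)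
    {φ : UnitAddCircle → ℂ} (hφ : Integrable φ AddCircle.haarAddCircle) :
    Integrable (fun w => f w * ∏ j, φ (w j)) (torusHaar n) := by
  have h1 : Integrable (fun w : Fin n → UnitAddCircle => ∏ j, φ (w j)) (torusHaar n) :=
    Integrable.fintype_prod (𝕜 := ℂ) (f := fun _ => φ) fun _ => hφ
  obtain ⟨C, hC⟩ := (isCompact_univ (X := Fin n → UnitAddCircle)).exists_bound_of_continuousOn
    hf.continuousOn
  exact h1.bdd_mul hf.aestronglyMeasurable (Eventually.of_forall fun w => hC w (Set.mem_univ _))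

/-- Reduction of the moment over `U(n + 1)` to an integral over `n` relative eigenangles. -/
theorem derivMoment_succ (k : ℂ) (n : ℕ) (hw : Integrable (weight k) AddCircle.haarAddCircle) :
    Integrable (fun A : UN (n + 1) => meanDerivPow k (A : Matrix (Fin (n + 1)) (Fin (n + 1)) ℂ))
      (haarUN (n + 1)) ∧
    derivMoment (n + 1) k = Complex.exp (Complex.I * π * k / 2) *
      (((n + 1).factorial : ℂ)⁻¹ * ∫ w, relWeight k w ∂(torusHaar n)) := by
  have hrel : Integrable (relWeight k : (Fin n → UnitAddCircle) → ℂ) (torusHaar n) :=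
    integrable_mul_prod (Complex.continuous_ofReal.comp (continuous_torusVand.norm.pow 2)) hw
  have hg : Measurable fun x : Fin (n + 1) → UnitAddCircle =>
      (1 / ((n + 1 : ℕ) : ℂ)) * ∑ r, torusDerivPow k x r :=
    measurable_const.mul (Finset.measurable_fun_sum _ fun r _ => measurable_torusDerivPow k r)
  have h := weyl_integration hg fun A x hx => meanDerivPow_eq_torus k hx
  have h1 : ∀ x : Fin (n + 1) → UnitAddCircle,
      ((‖torusVand x‖ ^ 2 / (n + 1).factorial : ℝ) : ℂ) *
        ((1 / ((n + 1 : ℕ) : ℂ)) * ∑ r, torusDerivPow k x r) =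
      (1 / ((n + 1 : ℕ) : ℂ)) * ((n + 1).factorial : ℂ)⁻¹ *
        Complex.exp (Complex.I * π * k / 2) * ∑ r, relWeight k (relative r x) := by
    intro x
    have : ((‖torusVand x‖ ^ 2 / (n + 1).factorial : ℝ) : ℂ) *
        ((1 / ((n + 1 : ℕ) : ℂ)) * ∑ r, torusDerivPow k x r) =
        (1 / ((n + 1 : ℕ) : ℂ)) * ((n + 1).factorial : ℂ)⁻¹ *
        ∑ r, ((‖torusVand x‖ ^ 2 : ℝ) : ℂ) * torusDerivPow k x r := by
      rw [← Finset.mul_sum]; push_cast; ring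
    rw [this]
    simp only [vand_mul_torusDerivPow, ← Finset.mul_sum, mul_assoc]
  simp_rw [h1] at h
  have h2 : ∀ r : Fin (n + 1), Integrable (fun x : Fin (n + 1) → UnitAddCircle =>
      relWeight k (relative r x)) (torusHaar (n + 1)) := fun r =>
    (measurePreserving_relative r).integrable_comp_of_integrable hrel
  refine ⟨h.1.2 ((integrable_finsetSum _ fun r _ => h2 r).const_mul _), ?_⟩
  have h3 : ∀ r : Fin (n + 1), ∫ x, relWeight k (relative r x) ∂(torusHaar (n + 1)) =
      ∫ w, relWeight k w ∂(torusHaar n) := by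
    intro r
    have := integral_map (measurePreserving_relative r).measurable.aemeasurable
      (f := relWeight k) ((measurePreserving_relative r).map_eq ▸ hrel.aestronglyMeasurable)
    rw [(measurePreserving_relative r).map_eq] at this
    exact this.symm
  rw [derivMoment, h.2, integral_const_mul, integral_finsetSum _ fun r _ => h2 r]
  simp only [h3, Finset.sum_const, Finset.card_univ, Fintype.card_fin, nsmul_eq_mul]
  have : ((n + 1 : ℕ) : ℂ) ≠ 0 := by exact_mod_cast n.succ_ne_zero
  field_simp

/-- Andréief's identity: expanding both determinants turns the integral into a Toeplitz
determinant. -/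
theorem integral_relWeight (k : ℂ) (n : ℕ)
    (hw : Integrable (weight k) AddCircle.haarAddCircle) :
    ∫ w, relWeight k w ∂(torusHaar n) = n.factorial *
      (Matrix.of fun i j : Fin n => ∫ y, circ y ^ ((j : ℤ) - (i : ℤ)) * weight k y
        ∂AddCircle.haarAddCircle).det := by
  classical
  set m : ℤ → ℂ := fun d => ∫ y, circ y ^ d * weight k y ∂AddCircle.haarAddCircle with hm
  have hint : ∀ d : ℤ, Integrable (fun y => circ y ^ d * weight k y) AddCircle.haarAddCircle := by
    intro d
    simp only [circ_zpow]
    exact hw.bdd_mul (fourier d).continuous.aestronglyMeasurable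
      (Eventually.of_forall fun y => (ContinuousMap.norm_coe_le_norm _ y))
  have h1 : ∀ w : Fin n → UnitAddCircle, relWeight k w =
      ∑ σ : Equiv.Perm (Fin n), ∑ τ : Equiv.Perm (Fin n),
        (((Equiv.Perm.sign σ : ℤ) : ℂ) * ((Equiv.Perm.sign τ : ℤ) : ℂ)) *
          ∏ j, (circ (w j) ^ (((τ j : Fin n) : ℤ) - ((σ j : Fin n) : ℤ)) * weight k (w j)) := by
    intro w
    have h2 : ((‖torusVand w‖ ^ 2 : ℝ) : ℂ) = (starRingEnd ℂ) (torusVand w) * torusVand w := by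
      rw [Complex.conj_mul']; push_cast; rfl
    have h3 : torusVand w = ∑ σ : Equiv.Perm (Fin n), ((Equiv.Perm.sign σ : ℤ) : ℂ) *
        ∏ j, circ (w j) ^ ((σ j : Fin n) : ℤ) := by
      rw [torusVand, ← Matrix.det_transpose, Matrix.det_apply']
      simp [Matrix.vandermonde_apply]
    rw [relWeight, h2, h3, map_sum, Finset.sum_mul_sum, Finset.sum_mul]
    refine Finset.sum_congr rfl fun σ _ => ?_
    rw [Finset.sum_mul]
    refine Finset.sum_congr rfl fun τ _ => ?_
    simp only [map_mul, map_prod, conj_circ_zpow, Finset.prod_mul_distrib, map_intCast,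
      sub_eq_add_neg, zpow_add₀ (circ_ne_zero _)]
    ring
  simp_rw [h1]
  have hprod : ∀ σ τ : Equiv.Perm (Fin n), Integrable (fun w : Fin n → UnitAddCircle =>
      ∏ j, (circ (w j) ^ (((τ j : Fin n) : ℤ) - ((σ j : Fin n) : ℤ)) * weight k (w j)))
      (torusHaar n) := fun σ τ =>
    Integrable.fintype_prod (𝕜 := ℂ)
      (f := fun j y => circ y ^ (((τ j : Fin n) : ℤ) - ((σ j : Fin n) : ℤ)) * weight k y)
      fun j => hint _
  rw [integral_finsetSum _ fun σ _ => integrable_finsetSum _ fun τ _ => (hprod σ τ).const_mul _]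
  have h4 : ∀ σ : Equiv.Perm (Fin n), ∫ w : Fin n → UnitAddCircle, ∑ τ : Equiv.Perm (Fin n),
        (((Equiv.Perm.sign σ : ℤ) : ℂ) * ((Equiv.Perm.sign τ : ℤ) : ℂ)) *
          ∏ j, (circ (w j) ^ (((τ j : Fin n) : ℤ) - ((σ j : Fin n) : ℤ)) * weight k (w j))
        ∂(torusHaar n) = (Matrix.of fun i j : Fin n => m ((j : ℤ) - (i : ℤ))).det := by
    intro σ
    rw [integral_finsetSum _ fun τ _ => (hprod σ τ).const_mul _]
    have h5 : ∀ τ : Equiv.Perm (Fin n), ∫ w : Fin n → UnitAddCircle,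
        (((Equiv.Perm.sign σ : ℤ) : ℂ) * ((Equiv.Perm.sign τ : ℤ) : ℂ)) *
          ∏ j, (circ (w j) ^ (((τ j : Fin n) : ℤ) - ((σ j : Fin n) : ℤ)) * weight k (w j))
        ∂(torusHaar n) = ((Equiv.Perm.sign (τ * σ⁻¹) : ℤ) : ℂ) *
          ∏ i, m ((((τ * σ⁻¹) i : Fin n) : ℤ) - ((i : Fin n) : ℤ)) := by
      intro τ
      rw [integral_const_mul, torusHaar, integral_fintype_prod_eq_prod (𝕜 := ℂ) (fun j y =>
        circ y ^ (((τ j : Fin n) : ℤ) - ((σ j : Fin n) : ℤ)) * weight k y)]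
      congr 1
      · simp [mul_comm]
      · rw [← Equiv.prod_comp σ
          fun i => m ((((τ * σ⁻¹) i : Fin n) : ℤ) - ((i : Fin n) : ℤ))]
        simp [hm]
    simp_rw [h5]
    refine (Equiv.sum_comp (Equiv.mulRight σ⁻¹) fun ρ : Equiv.Perm (Fin n) =>
      ((Equiv.Perm.sign ρ : ℤ) : ℂ) * ∏ i, m (((ρ i : Fin n) : ℤ) - ((i : Fin n) : ℤ))).trans ?_
    rw [← Matrix.det_transpose, Matrix.det_apply']
    rfl
  simp_rw [h4]
  rw [Finset.sum_const, Finset.card_univ, Fintype.card_perm, Fintype.card_fin, nsmul_eq_mul]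

/-! ### Fourier coefficients of `(1 - z) ^ s` -/

theorem circ_coe (θ : ℝ) :
    circ (θ : UnitAddCircle) = Complex.exp (Complex.I * (2 * π * θ : ℝ)) := by
  rw [circ, AddCircle.toCircle_apply_mk, Circle.coe_exp, mul_comm]
  simp

theorem haarAddCircle_eq_volume :
    (AddCircle.haarAddCircle : Measure UnitAddCircle) = volume := by
  have := AddCircle.volume_eq_smul_haarAddCircle (T := (1 : ℝ))
  rw [ENNReal.ofReal_one, one_smul] at this
  exact this.symm

theorem norm_one_sub_circ_le (y : UnitAddCircle) : ‖1 - circ y‖ ≤ 2 := by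
  refine (norm_sub_le _ _).trans ?_
  rw [norm_circ, norm_one]; norm_num

/-- Jordan's inequality, as a bound for the distance of a point of the circle from `1`. -/
theorem min_le_norm_one_sub_circ {θ : ℝ} (h0 : 0 ≤ θ) (h1 : θ ≤ 1) :
    min θ (1 - θ) ≤ ‖1 - circ (θ : UnitAddCircle)‖ := by
  rw [circ_coe, norm_sub_rev, Complex.norm_exp_I_mul_ofReal_sub_one, Real.norm_eq_abs]
  have hsin : 2 * min θ (1 - θ) ≤ Real.sin (π * θ) := by
    have hpi := Real.pi_pos
    rcases le_total θ (1 / 2) with h | h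
    · have := Real.mul_le_sin (x := π * θ) (by positivity) (by nlinarith)
      rw [min_eq_left (by linarith)]
      refine le_trans (le_of_eq ?_) this
      field_simp
    · have := Real.mul_le_sin (x := π * (1 - θ)) (mul_nonneg hpi.le (by linarith)) (by nlinarith)
      rw [min_eq_right (by linarith)]
      have e : Real.sin (π * θ) = Real.sin (π * (1 - θ)) := by
        rw [mul_sub, mul_one, Real.sin_pi_sub]
      rw [e]
      refine le_trans (le_of_eq ?_) this
      field_simp
  have hmin : 0 ≤ min θ (1 - θ) := le_min h0 (by linarith)
  have e2 : 2 * π * θ / 2 = π * θ := by ring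
  rw [e2]
  exact le_trans (by linarith) (le_abs_self _)

theorem integrable_norm_one_sub_circ_rpow {σ : ℝ} (hσ : -1 < σ) :
    Integrable (fun y => ‖1 - circ y‖ ^ σ) AddCircle.haarAddCircle := by
  have hm : Measurable fun y => ‖1 - circ y‖ ^ σ :=
    ((measurable_const.sub continuous_circ.measurable).norm).pow_const σ
  rcases le_or_gt 0 σ with h0 | h0
  · refine (integrable_const ((2 : ℝ) ^ σ)).mono' hm.aestronglyMeasurable
      (Eventually.of_forall fun y => ?_)
    rw [Real.norm_of_nonneg (Real.rpow_nonneg (norm_nonneg _) _)]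
    exact Real.rpow_le_rpow (norm_nonneg _) (norm_one_sub_circ_le y) h0
  · rw [haarAddCircle_eq_volume, ← (UnitAddCircle.measurePreserving_mk 0).integrable_comp
      hm.aestronglyMeasurable, zero_add]
    have i1 : IntegrableOn (fun θ : ℝ => θ ^ σ) (Set.Ioc 0 1) :=
      (intervalIntegrable_iff_integrableOn_Ioc_of_le zero_le_one).1
        (intervalIntegral.intervalIntegrable_rpow' hσ)
    have i2 : IntegrableOn (fun θ : ℝ => (1 - θ) ^ σ) (Set.Ioc 0 1) := by
      have := (intervalIntegral.intervalIntegrable_rpow' (a := 0) (b := 1) hσ).comp_sub_left 1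
      rw [sub_zero, sub_self] at this
      exact (intervalIntegrable_iff_integrableOn_Ioc_of_le zero_le_one).1 this.symm
    refine (i1.add i2).mono' (hm.comp AddCircle.measurable_mk').aestronglyMeasurable ?_
    refine (ae_restrict_iff' measurableSet_Ioc).2 (Eventually.of_forall fun θ hθ => ?_)
    have n1 : 0 ≤ θ ^ σ := Real.rpow_nonneg hθ.1.le _
    have n2 : 0 ≤ (1 - θ) ^ σ := Real.rpow_nonneg (by linarith [hθ.2]) _
    rw [Pi.add_apply, Function.comp_apply, Real.norm_of_nonneg (Real.rpow_nonneg (norm_nonneg _) _)]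
    rcases hθ.2.eq_or_lt with rfl | hlt
    · have : circ ((1 : ℝ) : UnitAddCircle) = 1 := by
        rw [circ_coe, mul_one, mul_comm]; push_cast; exact Complex.exp_two_pi_mul_I
      rw [this, sub_self, norm_zero, Real.zero_rpow h0.ne]
      positivity
    · have hpos : 0 < min θ (1 - θ) := lt_min hθ.1 (by linarith)
      refine (Real.rpow_le_rpow_of_nonpos hpos (min_le_norm_one_sub_circ hθ.1.le hθ.2)
        h0.le).trans ?_
      rcases min_choice θ (1 - θ) with h | h <;> rw [h] <;> linarith

theorem circ_ne_one_ae : ∀ᵐ y ∂(AddCircle.haarAddCircle : Measure UnitAddCircle), circ y ≠ 1 := by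
  rw [haarAddCircle_eq_volume, ← (UnitAddCircle.measurePreserving_mk 0).map_eq, zero_add]
  refine (ae_map_iff AddCircle.measurable_mk'.aemeasurable
    (continuous_circ.measurable (measurableSet_singleton (1 : ℂ)).compl)).2 ?_
  refine (ae_restrict_iff' measurableSet_Ioc).2 ?_
  filter_upwards [Measure.ae_ne volume (1 : ℝ)] with θ h1 hθ h
  have hlt : θ < 1 := lt_of_le_of_ne hθ.2 h1
  have := min_le_norm_one_sub_circ hθ.1.le hθ.2
  rw [h, sub_self, norm_zero] at this
  exact absurd this (not_le.2 (lt_min hθ.1 (by linarith)))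

theorem norm_cpow_le_exp (z s : ℂ) : ‖z ^ s‖ ≤ Real.exp (π * |s.im|) * ‖z‖ ^ s.re := by
  refine (Complex.norm_cpow_le z s).trans ?_
  rw [div_eq_inv_mul, ← Real.exp_neg]
  refine mul_le_mul_of_nonneg_right (Real.exp_le_exp.2 ?_) (Real.rpow_nonneg (norm_nonneg _) _)
  calc -(z.arg * s.im) ≤ |z.arg * s.im| := neg_le_abs _
    _ = |z.arg| * |s.im| := abs_mul _ _
    _ ≤ π * |s.im| := mul_le_mul_of_nonneg_right (Complex.abs_arg_le_pi z) (abs_nonneg _)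

theorem measurable_one_sub_cpow (s : ℂ) (r : ℝ) :
    Measurable fun y => (1 - (r : ℂ) * circ y) ^ s :=
  (measurable_const.sub (measurable_const.mul continuous_circ.measurable)).pow_const s

theorem integrable_one_sub_circ_cpow {s : ℂ} (hs : -1 < s.re) :
    Integrable (fun y => (1 - circ y) ^ s) AddCircle.haarAddCircle := by
  refine ((integrable_norm_one_sub_circ_rpow hs).const_mul (Real.exp (π * |s.im|))).mono' ?_
    (Eventually.of_forall fun y => norm_cpow_le_exp _ _)
  simpa using (measurable_one_sub_cpow s 1).aestronglyMeasurable

/-- The coefficient of `z ^ d` in the power series of `(1 - z) ^ s`, for integer `d`. -/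
noncomputable def binomCoeff (s : ℂ) : ℤ → ℂ
  | .ofNat n => (-1) ^ n * Ring.choose s n
  | .negSucc _ => 0

theorem hasSum_one_add_cpow (s : ℂ) {w : ℂ} (hw : ‖w‖ < 1) :
    HasSum (fun n : ℕ => Ring.choose s n * w ^ n) ((1 + w) ^ s) := by
  have h := (Complex.one_add_cpow_hasFPowerSeriesOnBall_zero (a := s)).hasSum (y := w)
    (by simpa [← ofReal_norm] using hw)
  rw [zero_add] at h
  have e : (fun n : ℕ => Ring.choose s n * w ^ n) =
      fun n : ℕ => binomialSeries ℂ s n fun _ => w := by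
    funext n
    rw [binomialSeries_apply, List.ofFn_const, List.prod_replicate, smul_eq_mul]
  rw [e]
  exact h

theorem integral_one_sub_mul_circ_cpow (s : ℂ) (d : ℤ) {r : ℝ} (h0 : 0 ≤ r) (h1 : r < 1) :
    ∫ y, circ y ^ (-d) * (1 - (r : ℂ) * circ y) ^ s ∂AddCircle.haarAddCircle =
      binomCoeff s d * (r : ℂ) ^ d.natAbs := by
  set F : ℕ → UnitAddCircle → ℂ := fun n y =>
    (Ring.choose s n * (-r : ℂ) ^ n) * fourier ((n : ℤ) - d) y with hF
  have hsum : ∀ y, ∑' n, F n y = circ y ^ (-d) * (1 - (r : ℂ) * circ y) ^ s := by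
    intro y
    have hw : ‖-(r : ℂ) * circ y‖ < 1 := by
      rw [norm_mul, norm_neg, Complex.norm_real, norm_circ, mul_one, Real.norm_of_nonneg h0]
      exact h1
    have h := (hasSum_one_add_cpow s hw).mul_left (circ y ^ (-d))
    rw [neg_mul, ← sub_eq_add_neg] at h
    rw [← h.tsum_eq]
    refine tsum_congr fun n => ?_
    rw [hF]
    simp only
    rw [← circ_zpow, sub_eq_add_neg, zpow_add₀ (circ_ne_zero y), zpow_natCast, ← neg_mul, mul_pow]
    ring
  have hnorm : Summable fun n => ∫ y, ‖F n y‖ ∂AddCircle.haarAddCircle := by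
    have h := (hasSum_one_add_cpow s (w := (-r : ℂ)) (by
      rw [norm_neg, Complex.norm_real, Real.norm_of_nonneg h0]; exact h1)).summable.norm
    refine h.congr fun n => ?_
    have : ∀ y : UnitAddCircle, ‖F n y‖ = ‖Ring.choose s n * (-r : ℂ) ^ n‖ := by
      intro y
      rw [hF]
      simp only
      rw [norm_mul, ← circ_zpow, norm_zpow, norm_circ, one_zpow, mul_one]
    simp [this]
  have hint : ∀ n, Integrable (F n) AddCircle.haarAddCircle := fun n =>
    ((fourier ((n : ℤ) - d)).continuous.integrable_of_hasCompactSupport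
      (HasCompactSupport.of_compactSpace _)).const_mul _
  have h := hasSum_integral_of_summable_integral_norm hint hnorm
  simp_rw [hsum] at h
  refine h.unique ?_
  have hval : ∀ n, ∫ y, F n y ∂AddCircle.haarAddCircle =
      (Ring.choose s n * (-r : ℂ) ^ n) * if (n : ℤ) - d = 0 then 1 else 0 := by
    intro n
    rw [hF]
    simp only
    rw [integral_const_mul, integral_fourier]
  simp_rw [hval]
  cases d with
  | ofNat m =>
    have := hasSum_single (f := fun n : ℕ => (Ring.choose s n * (-r : ℂ) ^ n) *
      if (n : ℤ) - Int.ofNat m = 0 then (1 : ℂ) else 0) m fun n hn => by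
        rw [if_neg, mul_zero]
        simp only [Int.ofNat_eq_natCast]
        omega
    have e : Ring.choose s m * (-r : ℂ) ^ m * (if (m : ℤ) - Int.ofNat m = 0 then (1 : ℂ) else 0) =
        (-1) ^ m * Ring.choose s m * (r : ℂ) ^ m := by
      rw [if_pos (show (m : ℤ) - Int.ofNat m = 0 from sub_self _), neg_pow (r : ℂ)]
      ring
    rw [e] at this
    exact this
  | negSucc m =>
    have : ∀ n : ℕ, ¬ ((n : ℤ) - Int.negSucc m = 0) := by intro n; omega
    simp only [this, if_false, mul_zero, binomCoeff, zero_mul]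
    exact hasSum_zero

/-- The Fourier coefficients of `(1 - z) ^ s`, by Abel summation: let `r → 1` in
`(1 - r z) ^ s`. -/
theorem integral_one_sub_circ_cpow {s : ℂ} (hs : -1 < s.re) (d : ℤ) :
    ∫ y, circ y ^ (-d) * (1 - circ y) ^ s ∂AddCircle.haarAddCircle = binomCoeff s d := by
  have hlim : Tendsto (fun r : ℝ => ∫ y, circ y ^ (-d) * (1 - (r : ℂ) * circ y) ^ s
      ∂AddCircle.haarAddCircle) (𝓝[<] 1)
      (𝓝 (∫ y, circ y ^ (-d) * (1 - circ y) ^ s ∂AddCircle.haarAddCircle)) := by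
    refine tendsto_integral_filter_of_dominated_convergence
      (fun y => Real.exp (π * |s.im|) * (2 ^ |s.re| * (1 + ‖1 - circ y‖ ^ s.re))) ?_ ?_ ?_ ?_
    · refine Eventually.of_forall fun r => ?_
      refine (Measurable.mul ?_ (measurable_one_sub_cpow s r)).aestronglyMeasurable
      simp only [circ_zpow]
      exact (fourier (-d)).continuous.measurable
    · filter_upwards [Ioo_mem_nhdsLT (zero_lt_one (α := ℝ))] with r hr
      filter_upwards [circ_ne_one_ae] with y hy
      rw [norm_mul, norm_zpow, norm_circ, one_zpow, one_mul]
      refine (norm_cpow_le_exp _ _).trans ?_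
      refine mul_le_mul_of_nonneg_left ?_ (Real.exp_nonneg _)
      have hrz : ‖(r : ℂ) * circ y‖ = r := by
        rw [norm_mul, norm_circ, mul_one, Complex.norm_real, Real.norm_of_nonneg hr.1.le]
      have hnn : 0 ≤ ‖1 - circ y‖ ^ s.re := Real.rpow_nonneg (norm_nonneg _) _
      have hle2 : ‖1 - (r : ℂ) * circ y‖ ≤ 2 := by
        refine (norm_sub_le _ _).trans ?_
        rw [hrz, norm_one]; linarith [hr.2]
      rcases le_or_gt 0 s.re with h | h
      · rw [abs_of_nonneg h]
        have := Real.rpow_le_rpow (norm_nonneg _) hle2 h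
        have h2 : (0 : ℝ) ≤ 2 ^ s.re := by positivity
        nlinarith
      · rw [abs_of_neg h]
        have hpos : 0 < ‖1 - circ y‖ := norm_pos_iff.2 (sub_ne_zero.2 hy.symm)
        -- the distance from `r z` to `z` is `1 - r`, which is at most that from `r z` to `1`
        have hge : ‖1 - circ y‖ / 2 ≤ ‖1 - (r : ℂ) * circ y‖ := by
          have e1 : ‖1 - circ y‖ ≤ ‖1 - (r : ℂ) * circ y‖ + ‖(r : ℂ) * circ y - circ y‖ := by
            have := norm_add_le (1 - (r : ℂ) * circ y) ((r : ℂ) * circ y - circ y)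
            simpa using this
          have e2 : ‖(r : ℂ) * circ y - circ y‖ = 1 - r := by
            have : (r : ℂ) * circ y - circ y = ((r - 1 : ℝ) : ℂ) * circ y := by push_cast; ring
            rw [this, norm_mul, norm_circ, mul_one, Complex.norm_real, Real.norm_eq_abs,
              abs_of_neg (by linarith [hr.2])]
            ring
          have e3 : 1 - r ≤ ‖1 - (r : ℂ) * circ y‖ := by
            have := norm_sub_norm_le (1 : ℂ) ((r : ℂ) * circ y)
            rwa [hrz, norm_one] at this
          linarith
        refine (Real.rpow_le_rpow_of_nonpos (by positivity) hge h.le).trans ?_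
        rw [Real.div_rpow (norm_nonneg _) (by norm_num), Real.rpow_neg (by norm_num),
          div_eq_inv_mul]
        refine mul_le_mul_of_nonneg_left (by linarith) (by positivity)
    · exact (((integrable_const (1 : ℝ)).add
        (integrable_norm_one_sub_circ_rpow hs)).const_mul _).const_mul _
    · filter_upwards [circ_ne_one_ae] with y hy
      refine Tendsto.const_mul _ ?_
      have hslit : 1 - ((1 : ℝ) : ℂ) * circ y ∈ Complex.slitPlane := by
        rw [Complex.ofReal_one, one_mul, Complex.mem_slitPlane_iff]
        by_contra hcon
        push Not at hcon
        have e1 : (circ y).im = 0 := by simpa using hcon.2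
        have e2 : 1 ≤ (circ y).re := by simpa using hcon.1
        have e3 : (circ y).re ≤ 1 := (Complex.re_le_norm _).trans (norm_circ y).le
        exact hy (Complex.ext (le_antisymm e3 e2) e1)
      have hc : ContinuousAt (fun r : ℝ => (1 - (r : ℂ) * circ y) ^ s) 1 :=
        ContinuousAt.cpow (by fun_prop) continuousAt_const hslit
      have := hc.tendsto
      rw [Complex.ofReal_one, one_mul] at this
      exact this.mono_left nhdsWithin_le_nhds
  have hlim2 : Tendsto (fun r : ℝ => ∫ y, circ y ^ (-d) * (1 - (r : ℂ) * circ y) ^ s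
      ∂AddCircle.haarAddCircle) (𝓝[<] 1) (𝓝 (binomCoeff s d)) := by
    have h1 : Tendsto (fun r : ℝ => binomCoeff s d * (r : ℂ) ^ d.natAbs) (𝓝[<] 1)
        (𝓝 (binomCoeff s d * ((1 : ℝ) : ℂ) ^ d.natAbs)) := by
      refine Tendsto.mono_left (Continuous.tendsto ?_ 1) nhdsWithin_le_nhds
      fun_prop
    rw [Complex.ofReal_one, one_pow, mul_one] at h1
    refine h1.congr' ?_
    filter_upwards [Ioo_mem_nhdsLT (zero_lt_one (α := ℝ))] with r hr
    exact (integral_one_sub_mul_circ_cpow s d hr.1.le hr.2).symm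
  exact tendsto_nhds_unique hlim hlim2

/-- Since `|1 - z| ^ 2 = -z⁻¹ (1 - z) ^ 2` on the circle, the weight is a monomial times a single
complex power. -/
theorem weight_ae_eq (k : ℂ) : weight k =ᵐ[AddCircle.haarAddCircle]
    fun y => -(circ y ^ (-1 : ℤ) * (1 - circ y) ^ (k + 2)) := by
  filter_upwards [circ_ne_one_ae] with y hy
  have h0 : 1 - circ y ≠ 0 := sub_ne_zero.2 hy.symm
  have h1 : ((‖1 - circ y‖ ^ 2 : ℝ) : ℂ) = (1 - circ y) * (1 - circ y ^ (-1 : ℤ)) := by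
    have := Complex.mul_conj' (1 - circ y)
    have h2 := conj_circ_zpow y 1
    rw [zpow_one] at h2
    rw [map_sub, map_one, h2] at this
    rw [this]; push_cast; rfl
  have h2 : circ y * circ y ^ (-1 : ℤ) = 1 := by
    rw [zpow_neg_one, mul_inv_cancel₀ (circ_ne_zero y)]
  rw [weight, h1, Complex.cpow_add _ _ h0]
  have h3 : (1 - circ y) ^ (2 : ℂ) = (1 - circ y) ^ 2 := by
    exact_mod_cast Complex.cpow_natCast (1 - circ y) 2
  rw [h3]
  linear_combination (-((1 - circ y) * (1 - circ y) ^ k)) * h2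

theorem integrable_weight {k : ℂ} (hk : -3 < k.re) :
    Integrable (weight k) AddCircle.haarAddCircle := by
  rw [integrable_congr (weight_ae_eq k)]
  have hs : -1 < (k + 2).re := by simp; linarith
  refine Integrable.neg ?_
  simp only [circ_zpow]
  exact (integrable_one_sub_circ_cpow hs).bdd_mul (fourier (-1)).continuous.aestronglyMeasurable
    (Eventually.of_forall fun y => (ContinuousMap.norm_coe_le_norm _ y))

theorem integral_zpow_mul_weight {k : ℂ} (hk : -3 < k.re) (d : ℤ) :
    ∫ y, circ y ^ d * weight k y ∂AddCircle.haarAddCircle = -binomCoeff (k + 2) (1 - d) := by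
  have hs : -1 < (k + 2).re := by simp; linarith
  rw [← integral_one_sub_circ_cpow hs, ← integral_neg]
  refine integral_congr_ae ?_
  filter_upwards [weight_ae_eq k] with y hy
  have h : circ y ^ (-(1 - d)) = circ y ^ d * circ y ^ (-1 : ℤ) := by
    rw [← zpow_add₀ (circ_ne_zero y)]
    congr 1
    ring
  rw [hy, h]
  ring

/-! ### The Toeplitz determinant -/

/-- The Toeplitz matrices of `(1 - z) ^ s` and `(1 - z) ^ (-s)` are inverse to each other, by the
Chu–Vandermonde identity. -/
theorem sum_binomCoeff_mul (s : ℂ) (n : ℕ) (i j : Fin (n + 1)) :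
    ∑ l : Fin (n + 1), binomCoeff s ((i : ℤ) - (l : ℤ)) * binomCoeff (-s) ((l : ℤ) - (j : ℤ)) =
      if i = j then 1 else 0 := by
  have hneg : ∀ (t : ℂ) (d : ℤ), d < 0 → binomCoeff t d = 0 := by
    intro t d hd
    cases d with
    | ofNat n => simp only [Int.ofNat_eq_natCast] at hd; omega
    | negSucc m => rfl
  rw [Fin.sum_univ_eq_sum_range (fun l : ℕ => binomCoeff s ((i : ℤ) - (l : ℤ)) *
    binomCoeff (-s) ((l : ℤ) - (j : ℤ))) (n + 1)]
  rcases lt_or_ge i j with hij | hij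
  · rw [if_neg hij.ne]
    refine Finset.sum_eq_zero fun l _ => ?_
    have hij' : (i : ℕ) < j := hij
    rcases lt_or_ge (i : ℕ) l with h | h
    · rw [hneg s _ (by omega), zero_mul]
    · rw [hneg (-s) _ (by omega), mul_zero]
  · have hij' : (j : ℕ) ≤ i := hij
    have hi := i.2
    have hsub : Finset.Ico (j : ℕ) (i + 1) ⊆ Finset.range (n + 1) := by
      intro l hl
      have := Finset.mem_Ico.1 hl
      exact Finset.mem_range.2 (by omega)
    rw [← Finset.sum_subset hsub fun l _ hl => ?_, Finset.sum_Ico_eq_sum_range]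
    · have hterm : ∀ a ∈ Finset.range ((i : ℕ) + 1 - j),
          binomCoeff s ((i : ℤ) - ((j + a : ℕ) : ℤ)) *
            binomCoeff (-s) (((j + a : ℕ) : ℤ) - (j : ℤ)) =
          (-1) ^ ((i : ℕ) - j) * (Ring.choose (-s) a * Ring.choose s ((i : ℕ) - j - a)) := by
        intro a ha
        have := Finset.mem_range.1 ha
        have e1 : (i : ℤ) - ((j + a : ℕ) : ℤ) = Int.ofNat ((i : ℕ) - j - a) := by
          simp only [Int.ofNat_eq_natCast]; omega
        have e2 : ((j + a : ℕ) : ℤ) - (j : ℤ) = Int.ofNat a := by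
          simp only [Int.ofNat_eq_natCast]; omega
        have e3 : (i : ℕ) - j = a + ((i : ℕ) - j - a) := by omega
        rw [e1, e2]
        simp only [binomCoeff]
        rw [e3, pow_add, ← e3]
        ring
      rw [Finset.sum_congr rfl hterm, ← Finset.mul_sum]
      have e4 : (i : ℕ) + 1 - j = ((i : ℕ) - j).succ := by omega
      rw [e4, ← Finset.Nat.sum_antidiagonal_eq_sum_range_succ
        (fun a b => Ring.choose (-s) a * Ring.choose s b), ← Ring.add_choose_eq _ (Commute.all _ _),
        neg_add_cancel, Ring.choose_zero_ite]
      rcases eq_or_ne i j with h | h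
      · simp [h]
      · have : (i : ℕ) - j ≠ 0 := by
          have := Fin.val_ne_of_ne h
          omega
        simp [h, this]
    · rw [Finset.mem_Ico, not_and_or, not_le, not_lt] at hl
      rcases hl with h | h
      · rw [hneg (-s) _ (by omega), mul_zero]
      · rw [hneg s _ (by omega), zero_mul]

/-- The Toeplitz determinant of the weight: it is, up to sign, a minor of the unitriangular Toeplitz
matrix of `(1 - z) ^ s`, hence an entry of the inverse matrix, which is that of
`(1 - z) ^ (-s)`. -/
theorem det_binomCoeff (s : ℂ) (n : ℕ) :
    (Matrix.of fun i j : Fin n => -binomCoeff s (1 - ((j : ℤ) - (i : ℤ)))).det =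
      (-1) ^ n * Ring.choose (-s) n := by
  set L : Matrix (Fin (n + 1)) (Fin (n + 1)) ℂ :=
    Matrix.of fun i j => binomCoeff s ((i : ℤ) - (j : ℤ)) with hL
  set D : Matrix (Fin (n + 1)) (Fin (n + 1)) ℂ :=
    Matrix.of fun i j => binomCoeff (-s) ((i : ℤ) - (j : ℤ)) with hD
  have hLD : L * D = 1 := by
    ext i j
    rw [Matrix.mul_apply, Matrix.one_apply]
    exact sum_binomCoeff_mul s n i j
  have hdet : L.det = 1 := by
    rw [Matrix.det_of_isLowerTriangular]
    · refine Finset.prod_eq_one fun i _ => ?_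
      rw [hL, Matrix.of_apply, sub_self]
      change binomCoeff s (Int.ofNat 0) = 1
      simp [binomCoeff]
    · intro i j hij
      have hij' : i < j := hij
      have h1 : (i : ℕ) < j := hij'
      rw [hL, Matrix.of_apply]
      obtain ⟨m, hm⟩ := Int.eq_negSucc_of_lt_zero (a := (i : ℤ) - (j : ℤ)) (by omega)
      rw [hm]; rfl
  -- as `L` has determinant one, its adjugate is its inverse `D`
  have hadj : L.adjugate = D := by
    have : L.adjugate * (L * D) = D := by
      rw [← mul_assoc, Matrix.adjugate_mul, hdet, one_smul, one_mul]
    rwa [hLD, mul_one] at this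
  have h1 := Matrix.adjugate_fin_succ_eq_det_submatrix L (Fin.last n) 0
  rw [hadj] at h1
  have h2 : (Matrix.of fun i j : Fin n => -binomCoeff s (1 - ((j : ℤ) - (i : ℤ)))) =
      -(L.submatrix (Fin.succAbove 0) (Fin.succAbove (Fin.last n))) := by
    ext i j
    rw [Matrix.neg_apply, Matrix.submatrix_apply, hL, Matrix.of_apply, Matrix.of_apply]
    congr 2
    simp
    ring
  rw [h2, Matrix.det_neg, Fintype.card_fin]
  have h3 : D (Fin.last n) 0 = (-1) ^ n * Ring.choose (-s) n := by
    rw [hD, Matrix.of_apply]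
    have : ((Fin.last n : Fin (n + 1)) : ℤ) - ((0 : Fin (n + 1)) : ℤ) = Int.ofNat n := by simp
    rw [this]; rfl
  rw [← h3, h1]
  simp

theorem choose_neg_eq (s : ℂ) (n : ℕ) : Ring.choose (-s) n = (-1) ^ n * Ring.multichoose s n := by
  rw [Ring.choose_neg']
  rcases Nat.even_or_odd n with h | h
  · rw [Int.negOnePow_even _ (by exact_mod_cast h), h.neg_one_pow]; simp
  · rw [Int.negOnePow_odd _ (by exact_mod_cast h), h.neg_one_pow]; simp

theorem factorial_mul_choose_neg (s : ℂ) (n : ℕ) :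
    (n.factorial : ℂ) * ((-1) ^ n * Ring.choose (-s) n) = ∏ j ∈ Finset.range n, (s + j) := by
  rw [choose_neg_eq, ← mul_assoc ((-1 : ℂ) ^ n), ← mul_pow, neg_one_mul, neg_neg, one_pow, one_mul,
    ← nsmul_eq_mul, Ring.factorial_nsmul_multichoose_eq_ascPochhammer]
  induction n with
  | zero => simp
  | succ n ih =>
    rw [Finset.prod_range_succ, ← ih, ascPochhammer_succ_right, Polynomial.smeval_mul,
      Polynomial.smeval_add, Polynomial.smeval_X, ← Polynomial.C_eq_natCast, Polynomial.smeval_C]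
    simp

/-! ### The moments and their asymptotics -/

/-- The moment in closed form, with `N = n + 1`; there is no exceptional value of `k`. -/
theorem derivMoment_eq_prod {k : ℂ} (hk : -3 < k.re) (n : ℕ) :
    derivMoment (n + 1) k = Complex.exp (Complex.I * π * k / 2) *
      ((∏ j ∈ Finset.range n, (k + 2 + j)) / (n + 1).factorial) := by
  have hw := integrable_weight hk
  rw [(derivMoment_succ k n hw).2, integral_relWeight k n hw]
  simp_rw [integral_zpow_mul_weight hk]
  rw [det_binomCoeff, factorial_mul_choose_neg, inv_mul_eq_div]

theorem prod_mul_Gamma {s : ℂ} (hs : ∀ j : ℕ, s + j ≠ 0) (n : ℕ) :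
    (∏ j ∈ Finset.range n, (s + j)) * Complex.Gamma s = Complex.Gamma (s + n) := by
  induction n with
  | zero => simp
  | succ n ih =>
    rw [Finset.prod_range_succ, mul_right_comm, ih, mul_comm, Nat.cast_succ, ← add_assoc,
      Complex.Gamma_add_one _ (hs n)]

theorem add_natCast_ne_zero {s : ℂ} (hs : -1 < s.re) (h0 : s ≠ 0) (j : ℕ) : s + j ≠ 0 := by
  rcases j with _ | j
  · simpa using h0
  · intro h
    have := congrArg Complex.re h
    simp at this
    have : (0 : ℝ) ≤ j := j.cast_nonneg
    linarith

theorem Gamma_ne_zero_of_re {s : ℂ} (hs : -1 < s.re) (h0 : s ≠ 0) : Complex.Gamma s ≠ 0 :=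
  Complex.Gamma_ne_zero fun m h => add_natCast_ne_zero hs h0 m (by rw [h, neg_add_cancel])

/-- At `k = -2` the first factor of the product vanishes. -/
theorem derivMoment_neg_two (n : ℕ) : derivMoment (n + 2) (-2) = 0 := by
  rw [derivMoment_eq_prod (by norm_num), Finset.prod_range_succ']
  simp

theorem derivMoment_eq_Gamma {k : ℂ} (hk : -3 < k.re) {N : ℕ} (hN : 1 ≤ N)
    (hne : ¬ (N = 1 ∧ k = -2)) :
    derivMoment N k = Complex.exp (Complex.I * π * k / 2) *
      (Complex.Gamma (N + k + 1) / (N.factorial * Complex.Gamma (k + 2))) := by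
  obtain ⟨n, rfl⟩ := Nat.exists_eq_add_of_le' hN
  by_cases h2 : k = -2
  · subst h2
    obtain ⟨m, rfl⟩ : ∃ m, n = m + 1 := Nat.exists_eq_succ_of_ne_zero fun h => hne ⟨by omega, rfl⟩
    rw [derivMoment_neg_two, neg_add_cancel, Complex.Gamma_zero]
    simp
  · have hs : -1 < (k + 2).re := by simp; linarith
    have h0 : k + 2 ≠ 0 := fun h => h2 (eq_neg_of_add_eq_zero_left h)
    rw [derivMoment_eq_prod hk]
    have e : ((n + 1 : ℕ) : ℂ) + k + 1 = k + 2 + n := by push_cast; ring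
    rw [e, ← prod_mul_Gamma (add_natCast_ne_zero hs h0), mul_div_mul_right _ _
      (Gamma_ne_zero_of_re hs h0)]

/-- Euler's limit formula for `Γ` at `k + 2`, in the form in which the moments appear. -/
theorem tendsto_prod_div_cpow {k : ℂ} (hs : -1 < (k + 2).re) (h0 : k + 2 ≠ 0) :
    Tendsto (fun n : ℕ => (∏ j ∈ Finset.range n, (k + 2 + j)) / (n + 1).factorial *
      Complex.Gamma (k + 2) / ((n + 1 : ℕ) : ℂ) ^ k) atTop (𝓝 1) := by
  have hG := Gamma_ne_zero_of_re hs h0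
  have h1 := ((Complex.GammaSeq_tendsto_Gamma (k + 2)).inv₀ hG).mul_const (Complex.Gamma (k + 2))
  rw [inv_mul_cancel₀ hG] at h1
  -- `GammaSeq (k + 2) (n + 1)` has the two further factors `k + 2 + n` and `k + 2 + (n + 1)`, and
  -- the power `(n + 1) ^ (k + 2)`
  have hr : Tendsto (fun n : ℕ => ((k + 2 + n) / ((n + 1 : ℕ) : ℂ)) *
      ((k + 2 + (n + 1 : ℕ)) / ((n + 1 : ℕ) : ℂ))) atTop (𝓝 (1 * 1)) := by
    have hinv : Tendsto (fun n : ℕ => (((n + 1 : ℕ) : ℂ))⁻¹) atTop (𝓝 0) :=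
      (tendsto_inv_atTop_nhds_zero_nat (𝕜 := ℂ)).comp (tendsto_add_atTop_nat 1)
    refine Tendsto.mul ?_ ?_
    · have := (hinv.const_mul (k + 1)).const_add 1
      rw [mul_zero, add_zero] at this
      refine this.congr fun n => ?_
      have : ((n + 1 : ℕ) : ℂ) ≠ 0 := Nat.cast_ne_zero.2 n.succ_ne_zero
      field_simp
      push_cast
      ring
    · have := (hinv.const_mul (k + 2)).const_add 1
      rw [mul_zero, add_zero] at this
      refine this.congr fun n => ?_
      have : ((n + 1 : ℕ) : ℂ) ≠ 0 := Nat.cast_ne_zero.2 n.succ_ne_zero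
      field_simp
      ring
  have h2 := (h1.comp (tendsto_add_atTop_nat 1)).div hr (by norm_num)
  rw [mul_one, div_one] at h2
  refine h2.congr fun n => ?_
  have hn : ((n + 1 : ℕ) : ℂ) ≠ 0 := Nat.cast_ne_zero.2 n.succ_ne_zero
  have hf : ((n + 1).factorial : ℂ) ≠ 0 := Nat.cast_ne_zero.2 (Nat.factorial_ne_zero _)
  have hc : ((n + 1 : ℕ) : ℂ) ^ k ≠ 0 := by
    rw [Complex.cpow_ne_zero_iff]
    exact Or.inl hn
  have hP := add_natCast_ne_zero hs h0
  have e2 : ((n + 1 : ℕ) : ℂ) ^ (2 : ℂ) = ((n + 1 : ℕ) : ℂ) ^ 2 := by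
    exact_mod_cast Complex.cpow_natCast ((n + 1 : ℕ) : ℂ) 2
  have h3 := hP n
  have h4 := hP (n + 1)
  rw [Pi.div_apply, Function.comp_apply, Complex.GammaSeq, Complex.cpow_add _ _ hn, e2,
    Finset.prod_range_succ, Finset.prod_range_succ]
  generalize hN : ((n + 1 : ℕ) : ℂ) = M at *
  generalize (∏ j ∈ Finset.range n, (k + 2 + (j : ℂ))) = p
  generalize k + 2 + (n : ℂ) = a at *
  generalize k + 2 + M = b at *
  field_simp

theorem derivMoment_isEquivalent {k : ℂ} (hk : -3 < k.re) :
    Asymptotics.IsEquivalent atTop (fun N : ℕ => derivMoment N k)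
      (fun N : ℕ => Complex.exp (Complex.I * π * k / 2) / Complex.Gamma (k + 2) * (N : ℂ) ^ k) := by
  by_cases h2 : k = -2
  · subst h2
    refine EventuallyEq.isEquivalent ?_
    filter_upwards [eventually_ge_atTop 2] with N hN
    obtain ⟨m, rfl⟩ := Nat.exists_eq_add_of_le' hN
    rw [derivMoment_neg_two, neg_add_cancel, Complex.Gamma_zero, div_zero, zero_mul]
  · have hs : -1 < (k + 2).re := by simp; linarith
    have h0 : k + 2 ≠ 0 := fun h => h2 (eq_neg_of_add_eq_zero_left h)
    have hG := Gamma_ne_zero_of_re hs h0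
    have hne : ∀ᶠ N : ℕ in atTop,
        Complex.exp (Complex.I * π * k / 2) / Complex.Gamma (k + 2) * (N : ℂ) ^ k ≠ 0 := by
      filter_upwards [eventually_ge_atTop 1] with N hN
      refine mul_ne_zero (div_ne_zero (Complex.exp_ne_zero _) hG) ?_
      rw [Complex.cpow_ne_zero_iff]
      exact Or.inl (Nat.cast_ne_zero.2 (by omega))
    refine (Asymptotics.isEquivalent_iff_tendsto_one hne).2
      ((tendsto_add_atTop_iff_nat 1).1 ((tendsto_prod_div_cpow hs h0).congr fun n => ?_))
    rw [Pi.div_apply, derivMoment_eq_prod hk]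
    have he := Complex.exp_ne_zero (Complex.I * π * k / 2)
    have hc : ((n + 1 : ℕ) : ℂ) ^ k ≠ 0 := by
      rw [Complex.cpow_ne_zero_iff]
      exact Or.inl (Nat.cast_ne_zero.2 (by omega))
    generalize ((n + 1 : ℕ) : ℂ) ^ k = c at *
    generalize Complex.exp (Complex.I * π * k / 2) = e at *
    field_simp

end UnitaryMoments

theorem mainTheorem1 (k : ℂ) (hk : -3 < k.re) :
    (∀ N : ℕ, 1 ≤ N →
      Integrable (fun A : UnitaryMoments.UN N =>
        UnitaryMoments.meanDerivPow k (A : Matrix (Fin N) (Fin N) ℂ)) (UnitaryMoments.haarUN N)) ∧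
    (∀ N : ℕ, 1 ≤ N → ¬ (N = 1 ∧ k = -2) →
      UnitaryMoments.derivMoment N k =
        Complex.exp (Complex.I * π * k / 2) *
          (Complex.Gamma (N + k + 1) / (N.factorial * Complex.Gamma (k + 2)))) ∧
    (k = -2 → UnitaryMoments.derivMoment 1 k = Complex.exp (Complex.I * π * k / 2)) ∧
    Asymptotics.IsEquivalent atTop (fun N : ℕ => UnitaryMoments.derivMoment N k)
      (fun N : ℕ => Complex.exp (Complex.I * π * k / 2) / Complex.Gamma (k + 2) * (N : ℂ) ^ k) := by
  refine ⟨fun N hN => ?_, fun N hN hne => UnitaryMoments.derivMoment_eq_Gamma hk hN hne,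
    fun _ => ?_, UnitaryMoments.derivMoment_isEquivalent hk⟩
  · obtain ⟨n, rfl⟩ := Nat.exists_eq_add_of_le' hN
    exact (UnitaryMoments.derivMoment_succ k n (UnitaryMoments.integrable_weight hk)).1
  · simpa using UnitaryMoments.derivMoment_eq_prod hk 0
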